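/- Let $\gamma \ge 1$ and put $\alpha = 1+\gamma-\sqrt{\gamma^2+2\gamma}$; then $\alpha\in(0,1)$. Let $\beta$ be a real number with $\beta > \frac{1}{1-\alpha}$, and let $\Omega\subset\mathbb{R}^2$ be a bounded open set. There is a constant $C = C(\gamma,\beta,\Omega)$ such that the following holds. Let $a,b,c,f:\Omega\to\mathbb{R}$ be functions (no continuity or other regularity of $a,b,c$ is assumed), and let $u\in C^2(\Omega)$ satisfy $$a\,u_{xx}+2b\,u_{xy}+c\,u_{yy}=f\quad\text{in }\Omega .$$ For $z\in\Omega$ let $\lambda(z)\le\Lambda(z)$ be the eigenvalues of $\begin{pmatrix} a(z)&b(z)\\ b(z)&c(z)\end{pmatrix}$, and assume that $\lambda(z)>0$ and $\Lambda(z)/\lambda(z)\le\gamma$ for all $z\in\Omega$, and that $f/\lambda\in L^{2\beta}(\Omega)$. Then $$|u|^*_{1,\alpha}\le C\left(|u|_0+\|f/\lambda\|_{L^{2\beta}(\Omega)}\right).$$ Here, with $d_z=\operatorname{dist}(z,\partial\Omega)$, $$|u|_0=\sup_{\Omega}|u|,\qquad |u|^*_{1,\alpha}=|u|_0+\sup_{z\in\Omega}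 d_z|Du(z)|+\sup_{z\ne w\in\Omega}\min(d_z,d_w)^{1+\alpha}\frac{|Du(z)-Du(w)|}{|z-w|^{\alpha}},$$ all suprema being taken in $[0,\infty]$ (and equal to $0$ over an empty set); in particular $|u|^*_{1,\alpha}$ is finite whenever $u$ is bounded. -/

import Mathlib

open scoped ENNReal NNReal

noncomputable section

namespace PlanarElliptic

/-- The Euclidean plane; the coordinates of `z` are `z 0 = x` and `z 1 = y`. -/
abbrev Plane : Type := EuclideanSpace ℝ (Fin 2)

/-- The first order partial derivative of `u` in the `i`-th coordinate direction. -/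
def pderiv (i : Fin 2) (u : Plane → ℝ) (z : Plane) : ℝ :=
  fderiv ℝ u z (EuclideanSpace.single i 1)

/-- The operator `L u = a u_xx + 2 b u_xy + c u_yy`. -/
def ellipticOp (a b c : Plane → ℝ) (u : Plane → ℝ) (z : Plane) : ℝ :=
  a z * pderiv 0 (pderiv 0 u) z + 2 * b z * pderiv 1 (pderiv 0 u) z
    + c z * pderiv 1 (pderiv 1 u) z

/-- The coefficient matrix of `L` at the point `z`. -/
def coeffMatrix (a b c : Plane → ℝ) (z : Plane) : Matrix (Fin 2) (Fin 2) ℝ :=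
  !![a z, b z; b z, c z]

/-- `l z` and `m z` are the smaller and the larger eigenvalue of the coefficient matrix, at every
point `z` of `Ω`. -/
def AreEigenvalues (Ω : Set Plane) (a b c l m : Plane → ℝ) : Prop :=
  ∀ z ∈ Ω, IsLeast (spectrum ℝ (coeffMatrix a b c z)) (l z) ∧
    IsGreatest (spectrum ℝ (coeffMatrix a b c z)) (m z)

/-- The distance `d_z` of `z` to the boundary of `Ω`. -/
def bdist (Ω : Set Plane) (z : Plane) : ℝ := Metric.infDist z (frontier Ω)

/-- `|u|_0`, the supremum of `|u|` over `Ω`, possibly `∞`. -/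
def supNorm (Ω : Set Plane) (u : Plane → ℝ) : ℝ≥0∞ :=
  ⨆ z ∈ Ω, ENNReal.ofReal |u z|

/-- `[u]^*_1`, the supremum of `d_z |Du(z)|` over `Ω`, possibly `∞`. The operator norm of the
derivative is the Euclidean norm of the gradient. -/
def intSeminormOne (Ω : Set Plane) (u : Plane → ℝ) : ℝ≥0∞ :=
  ⨆ z ∈ Ω, ENNReal.ofReal (bdist Ω z * ‖fderiv ℝ u z‖)

/-- `[u]^*_{1,α}`, the supremum of `min (d_z, d_w) ^ (1 + α) |Du(z) - Du(w)| / |z - w| ^ α` over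
distinct points `z`, `w` of `Ω`, possibly `∞`. -/
def intSeminormHolder (Ω : Set Plane) (α : ℝ) (u : Plane → ℝ) : ℝ≥0∞ :=
  ⨆ z ∈ Ω, ⨆ w ∈ Ω, ⨆ _ : z ≠ w,
    ENNReal.ofReal ((min (bdist Ω z) (bdist Ω w)) ^ (1 + α) *
      (‖fderiv ℝ u z - fderiv ℝ u w‖ / ‖z - w‖ ^ α))

/-- `|u|^*_{1,α} = |u|_0 + [u]^*_1 + [u]^*_{1,α}`. -/
def intNorm (Ω : Set Plane) (α : ℝ) (u : Plane → ℝ) : ℝ≥0∞ :=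
  supNorm Ω u + intSeminormOne Ω u + intSeminormHolder Ω α u

/-- The exponent `α = 1 + γ - (γ ^ 2 + 2 γ) ^ (1 / 2)`. -/
def holderExp (γ : ℝ) : ℝ := 1 + γ - Real.sqrt (γ ^ 2 + 2 * γ)

end PlanarElliptic

end

/-!
The gradient `(p, q) = (u_x, u_y)` of a solution is a quasiconformal map up to the right-hand side.
Multiplying the equation by `u_xx` and by `u_yy` and adding gives, with `g = f / λ`, the pointwise
inequality `|D²u|² ≤ K J + k` (`sq_sum_le_of_equation`), where `J = u_xy² - u_xx u_yy` is the
Jacobian of the gradient map up to sign, `K = 10/9 (1 + γ)` and `k = (7 + γ) g²`. No regularity of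
the coefficients enters.

The Jacobian is a divergence (`integral_weight_mul_jacobian`), so against a radial weight `G` it only
sees the derivatives of `p` and `q` along circles, and the isoperimetric inequality on each circle
bounds `∫ G J` by `∫ |z - z₀| |∇G| |D²u|²` with a constant (`abs_integral_radial_mul_negHessDet_le`).
For `G = |z - z₀| ^ (-2 α)`, suitably truncated, `|z - z₀| |∇G| = 2 α G`, and since `K α ≤ 3/5`
(`mul_holderExp_le`) the Jacobian term is absorbed on the left, although the isoperimetric inequality
is used with a constant that is not optimal. This leaves the contribution of the truncation, which is
controlled by a Caccioppoli argument (`setIntegral_hessSq_half_ball_le`) in terms of `sup |u|`, and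
`∫ |z - z₀| ^ (-2 α) g²`, which Hölder's inequality bounds by the square of the `L^{2 β}` norm of `g`
exactly when `β > 1 / (1 - α)` (`exists_setIntegral_rpow_mul_sq_le`). Hence the integral of `|D²u|²`
over a ball of radius `r` is `O(r ^ (2 α))` (`exists_setIntegral_hessSq_le`).

Morrey's criterion (`norm_sub_le_of_dirichlet_growth`) turns this growth into Hölder continuity of
the gradient on a ball whose radius is comparable to the distance to the boundary. The mean value
inequality then bounds the gradient itself by `sup |u|` and the Hölder constant
(`mul_norm_fderiv_le_of_holder`), and pairs of points that are far apart need nothing more.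
Multiplying `u` by a bump function makes all integrations by parts global.
-/

namespace PlanarElliptic

open MeasureTheory Set Filter Topology

/-! ### Integration by parts in the plane -/

lemma contDiff_pderiv {n : WithTop ℕ∞} {u : Plane → ℝ} (hu : ContDiff ℝ (n + 1) u) (i : Fin 2) :
    ContDiff ℝ n (pderiv i u) :=
  (hu.fderiv_right le_rfl).clm_apply contDiff_const

lemma continuous_pderiv {u : Plane → ℝ} (hu : ContDiff ℝ 1 u) (i : Fin 2) :
    Continuous (pderiv i u) :=
  (contDiff_pderiv (n := 0) (by simpa using hu) i).continuous

lemma hasCompactSupport_pderiv {u : Plane → ℝ} (hu : HasCompactSupport u) (i : Fin 2) :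
    HasCompactSupport (pderiv i u) :=
  hu.fderiv_apply (𝕜 := ℝ) _

lemma pderiv_mul {f g : Plane → ℝ} (hf : ContDiff ℝ 1 f) (hg : ContDiff ℝ 1 g) (i : Fin 2)
    (z : Plane) : pderiv i (fun z => f z * g z) z = f z * pderiv i g z + g z * pderiv i f z := by
  have h := fderiv_fun_mul (hf.differentiable one_ne_zero z) (hg.differentiable one_ne_zero z)
  simp [pderiv, h]

lemma pderiv_comm {u : Plane → ℝ} (hu : ContDiff ℝ 2 u) (i j : Fin 2) (z : Plane) :
    pderiv i (pderiv j u) z = pderiv j (pderiv i u) z := by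
  have hd : DifferentiableAt ℝ (fderiv ℝ u) z :=
    (hu.fderiv_right (m := 1) (by norm_num)).differentiable one_ne_zero z
  have key : ∀ i j : Fin 2, pderiv i (pderiv j u) z =
      fderiv ℝ (fderiv ℝ u) z (EuclideanSpace.single i 1) (EuclideanSpace.single j 1) := by
    intro i j
    unfold pderiv
    rw [fderiv_clm_apply hd (differentiableAt_const _)]
    simp
  rw [key, key]
  exact (hu.contDiffAt.isSymmSndFDerivAt (by simp)).eq _ _

lemma integral_pderiv_eq_zero {f : Plane → ℝ} (hf : ContDiff ℝ 1 f) (hc : HasCompactSupport f)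
    (i : Fin 2) : ∫ z, pderiv i f z = 0 := by
  have h1 : Integrable (pderiv i f) :=
    (continuous_pderiv hf i).integrable_of_hasCompactSupport (hasCompactSupport_pderiv hc i)
  have h2 : Integrable f := hf.continuous.integrable_of_hasCompactSupport hc
  have h := integral_mul_fderiv_eq_neg_fderiv_mul_of_integrable (μ := (volume : Measure Plane))
    (f := fun _ : Plane => (1 : ℝ)) (g := f) (v := EuclideanSpace.single i 1) (by simp)
    (by simp only [one_mul]; exact h1) (by simpa only [one_mul] using h2)
    (by simp) (fun x _ => hf.differentiable one_ne_zero x)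
  simpa [pderiv] using h

lemma pderiv_convolution {f g : Plane → ℝ} (hf : Continuous f) (hg : ContDiff ℝ 1 g)
    (hc : HasCompactSupport g) (i : Fin 2) :
    pderiv i (convolution f g (ContinuousLinearMap.mul ℝ ℝ) volume) =
      convolution f (pderiv i g) (ContinuousLinearMap.mul ℝ ℝ) volume := by
  ext x
  have h := hc.hasFDerivAt_convolution_right (ContinuousLinearMap.mul ℝ ℝ)
    (hf.locallyIntegrable (μ := volume)) hg x
  unfold pderiv
  rw [h.fderiv, convolution_precompR_apply _ (hf.locallyIntegrable (μ := volume)) (hc.fderiv ℝ)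
    (hg.continuous_fderiv one_ne_zero)]

/-- The product of a first order derivative of `h` and one of `q` has the same integral after the
two directions are interchanged. Only one derivative of each function is available, so the second
derivatives are taken on the convolution of the two functions. -/
lemma integral_pderiv_mul_pderiv_comm {h q : Plane → ℝ} (hh : ContDiff ℝ 1 h)
    (hhc : HasCompactSupport h) (hq : ContDiff ℝ 1 q) (hqc : HasCompactSupport q) (i j : Fin 2) :
    ∫ z, pderiv i h z * pderiv j q z = ∫ z, pderiv j h z * pderiv i q z := by
  have comm : ∀ f g : Plane → ℝ, convolution f g (ContinuousLinearMap.mul ℝ ℝ) volume =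
      convolution g f (ContinuousLinearMap.mul ℝ ℝ) volume := by
    intro f g
    rw [← convolution_flip]
    congr 1
    ext
    simp
  set r : Plane → ℝ := fun z => q (-z) with hr
  have hr1 : ContDiff ℝ 1 r := hq.comp contDiff_neg
  have hrc : HasCompactSupport r := hqc.comp_homeomorph (Homeomorph.neg Plane)
  have key : ∀ i j : Fin 2, convolution (pderiv i h) (pderiv j r)
      (ContinuousLinearMap.mul ℝ ℝ) volume = pderiv j (pderiv i
        (convolution r h (ContinuousLinearMap.mul ℝ ℝ) volume)) := by
    intro i j
    rw [← pderiv_convolution (continuous_pderiv hh i) hr1 hrc, comm,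
      ← pderiv_convolution hr1.continuous hh hhc]
  have key' : convolution (pderiv i h) (pderiv j r) (ContinuousLinearMap.mul ℝ ℝ) volume =
      convolution (pderiv j h) (pderiv i r) (ContinuousLinearMap.mul ℝ ℝ) volume := by
    rw [key, comm r h, pderiv_convolution hh.continuous hr1 hrc, comm,
      pderiv_convolution (continuous_pderiv hr1 i) hh hhc, comm]
  have hrd : ∀ k z, pderiv k r (-z) = - pderiv k q z := by
    intro k z
    have h1 : HasFDerivAt r ((fderiv ℝ q (- -z)).comp (-ContinuousLinearMap.id ℝ Plane)) (-z) :=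
      (hq.differentiable one_ne_zero _).hasFDerivAt.comp (-z) (hasFDerivAt_id _).neg
    unfold pderiv
    rw [h1.fderiv]
    simp
  have h0 := congrFun key' 0
  simp only [convolution_def, zero_sub, hrd, ContinuousLinearMap.mul_apply', mul_neg,
    integral_neg, neg_inj] at h0
  exact h0

/-- The Jacobian determinant of `(p, q)` is a divergence; with a weight `G` the derivatives of `p`
can be moved to `G`. -/
lemma integral_weight_mul_jacobian {G p q : Plane → ℝ} (hG : ContDiff ℝ 1 G)
    (hp : ContDiff ℝ 1 p) (hpc : HasCompactSupport p) (hq : ContDiff ℝ 1 q)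
    (hqc : HasCompactSupport q) :
    ∫ z, G z * (pderiv 1 p z * pderiv 0 q z - pderiv 0 p z * pderiv 1 q z) =
      ∫ z, p z * (pderiv 0 G z * pderiv 1 q z - pderiv 1 G z * pderiv 0 q z) := by
  have hGp : ContDiff ℝ 1 (fun z => G z * p z) := hG.mul hp
  have hGpc : HasCompactSupport (fun z => G z * p z) := hpc.mul_left
  have h := integral_pderiv_mul_pderiv_comm hGp hGpc hq hqc 1 0
  have cG := fun i => continuous_pderiv hG i
  have cp := fun i => continuous_pderiv hp i
  have cq := fun i => continuous_pderiv hq i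
  have cGp := fun i => continuous_pderiv hGp i
  have hi : ∀ i j, Integrable (fun z => pderiv i (fun z => G z * p z) z * pderiv j q z) :=
    fun i j => ((cGp i).mul (cq j)).integrable_of_hasCompactSupport
      ((hasCompactSupport_pderiv hqc j).mul_left)
  rw [← sub_eq_zero, ← integral_sub (hi 1 0) (hi 0 1)] at h
  rw [← sub_eq_zero, ← integral_sub, ← h]
  · congr 1
    ext z
    rw [pderiv_mul hG hp, pderiv_mul hG hp]
    ring
  · refine Continuous.integrable_of_hasCompactSupport ?_ ?_
    · have := hG.continuous
      fun_prop
    · exact HasCompactSupport.mul_left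
        (((hasCompactSupport_pderiv hqc 0).mul_left).sub ((hasCompactSupport_pderiv hqc 1).mul_left))
  · refine Continuous.integrable_of_hasCompactSupport ?_ hpc.mul_right
    have := hp.continuous
    fun_prop

/-! ### An isoperimetric inequality on circles -/

lemma sq_integral_le_measureReal_mul_integral_sq {X : Type*} [MeasurableSpace X] {μ : Measure X}
    [IsFiniteMeasure μ] {f : X → ℝ} (hf : Integrable f μ) (hf2 : Integrable (fun x => f x ^ 2) μ) :
    (∫ x, f x ∂μ) ^ 2 ≤ μ.real univ * ∫ x, f x ^ 2 ∂μ := by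
  rcases eq_or_ne μ 0 with rfl | hμ
  · simp
  have hμ0 : 0 < μ.real univ :=
    ENNReal.toReal_pos (by simpa using hμ) (measure_ne_top _ _)
  set m := (∫ x, f x ∂μ) / μ.real univ with hm
  have h0 : 0 ≤ ∫ x, (f x - m) ^ 2 ∂μ := integral_nonneg fun x => sq_nonneg _
  have h1 : ∫ x, (f x - m) ^ 2 ∂μ =
      (∫ x, f x ^ 2 ∂μ) - 2 * m * (∫ x, f x ∂μ) + μ.real univ * m ^ 2 := by
    have : ∀ x, (f x - m) ^ 2 = f x ^ 2 - 2 * m * f x + m ^ 2 := fun x => by ring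
    simp only [this]
    have hi : Integrable (fun x => f x ^ 2 - 2 * m * f x) μ := hf2.sub (hf.const_mul _)
    rw [integral_add hi (integrable_const _), integral_sub hf2 (hf.const_mul _),
      integral_const_mul, integral_const, smul_eq_mul]
  have h2 : ∫ x, f x ∂μ = m * μ.real univ := by rw [hm]; field_simp
  rw [h1, h2] at h0
  rw [h2]
  nlinarith

lemma sq_integral_le_mul_integral_sq {a b : ℝ} (hab : a ≤ b) {f : ℝ → ℝ} (hf : Continuous f) :
    (∫ t in a..b, f t) ^ 2 ≤ (b - a) * ∫ t in a..b, f t ^ 2 := by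
  have h := sq_integral_le_measureReal_mul_integral_sq (μ := volume.restrict (Ioc a b))
    (hf.intervalIntegrable a b).1 ((hf.pow 2).intervalIntegrable a b).1
  rw [intervalIntegral.integral_of_le hab, intervalIntegral.integral_of_le hab]
  simpa [hab] using h

/-- The oscillation of a periodic function is at most half of its total variation, since two
points of a circle are joined by two arcs. -/
lemma abs_sub_le_half_integral {p p' : ℝ → ℝ} {a b : ℝ} (hp : ∀ t, HasDerivAt p (p' t) t)
    (hp' : Continuous p') (hper : p a = p b) {s t : ℝ} (has : a ≤ s) (hst : s ≤ t) (htb : t ≤ b) :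
    |p s - p t| ≤ (∫ x in a..b, |p' x|) / 2 := by
  have key : ∀ x y, x ≤ y → |p y - p x| ≤ ∫ r in x..y, |p' r| := by
    intro x y hxy
    rw [← intervalIntegral.integral_eq_sub_of_hasDerivAt (fun r _ => hp r)
      (hp'.intervalIntegrable _ _)]
    exact intervalIntegral.abs_integral_le_integral_abs hxy
  have hi : ∀ x y, IntervalIntegrable (fun r => |p' r|) volume x y :=
    fun x y => hp'.abs.intervalIntegrable _ _
  have hsum := intervalIntegral.integral_add_adjacent_intervals (hi a s) (hi s t)
  have hsum' := intervalIntegral.integral_add_adjacent_intervals (hi a t) (hi t b)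
  have h1 := key a s has
  have h2 := key s t hst
  have h3 := key t b htb
  rw [abs_le] at *
  constructor <;> linarith

/-- The isoperimetric inequality for closed curves `(p, q)` with a constant that is `π / 2` times
the optimal one. -/
lemma abs_integral_mul_deriv_le {p q p' q' : ℝ → ℝ} {a b : ℝ} (hab : a ≤ b)
    (hp : ∀ t, HasDerivAt p (p' t) t) (hq : ∀ t, HasDerivAt q (q' t) t)
    (hp' : Continuous p') (hq' : Continuous q') (hpab : p a = p b) (hqab : q a = q b) :
    |∫ t in a..b, p t * q' t| ≤ (b - a) / 8 * ∫ t in a..b, (p' t ^ 2 + q' t ^ 2) := by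
  have cp : Continuous p := continuous_iff_continuousAt.2 fun t => (hp t).continuousAt
  obtain ⟨x, hx, hxm⟩ := isCompact_Icc.exists_isMinOn (nonempty_Icc.2 hab) cp.continuousOn
  obtain ⟨y, hy, hym⟩ := isCompact_Icc.exists_isMaxOn (nonempty_Icc.2 hab) cp.continuousOn
  set L := ∫ t in a..b, |p' t| with hL
  set M := ∫ t in a..b, |q' t| with hM
  have hosc : p y - p x ≤ L / 2 := by
    rcases le_total x y with h | h
    · have := abs_sub_le_half_integral hp hp' hpab hx.1 h hy.2
      rw [abs_le] at this; linarith
    · have := abs_sub_le_half_integral hp hp' hpab hy.1 h hx.2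
      rw [abs_le] at this; linarith
  -- Subtracting the midrange of `p` does not change the integral.
  set c := (p x + p y) / 2 with hc
  have hdev : ∀ t ∈ Icc a b, |p t - c| ≤ L / 4 := by
    intro t ht
    have h1 : p x ≤ p t := hxm ht
    have h2 : p t ≤ p y := hym ht
    rw [abs_le]
    constructor <;> linarith
  have hq0 : ∫ t in a..b, q' t = 0 := by
    rw [intervalIntegral.integral_eq_sub_of_hasDerivAt (fun r _ => hq r)
      (hq'.intervalIntegrable _ _), hqab, sub_self]
  have heq : ∫ t in a..b, p t * q' t = ∫ t in a..b, (p t - c) * q' t := by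
    simp only [sub_mul]
    rw [intervalIntegral.integral_sub, intervalIntegral.integral_const_mul, hq0]
    · simp
    all_goals exact Continuous.intervalIntegrable (by fun_prop) _ _
  have hle : |∫ t in a..b, p t * q' t| ≤ L / 4 * M := by
    rw [heq, hM, ← intervalIntegral.integral_const_mul]
    refine (intervalIntegral.abs_integral_le_integral_abs hab).trans ?_
    refine intervalIntegral.integral_mono_on hab ?_ ?_ fun t ht => ?_
    · exact Continuous.intervalIntegrable (by fun_prop) _ _
    · exact Continuous.intervalIntegrable (by fun_prop) _ _
    · rw [abs_mul]
      exact mul_le_mul_of_nonneg_right (hdev t ht) (abs_nonneg _)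
  have hL2 := sq_integral_le_mul_integral_sq hab hp'.abs
  have hM2 := sq_integral_le_mul_integral_sq hab hq'.abs
  simp only [sq_abs] at hL2 hM2
  rw [intervalIntegral.integral_add]
  · nlinarith [sq_nonneg (L - M)]
  all_goals exact Continuous.intervalIntegrable (by fun_prop) _ _

/-- The derivative of `q` along circles around `z₀`, with respect to the angle. -/
noncomputable def angularDeriv (z₀ : Plane) (q : Plane → ℝ) (z : Plane) : ℝ :=
  (z 0 - z₀ 0) * pderiv 1 q z - (z 1 - z₀ 1) * pderiv 0 q z

lemma continuous_angularDeriv (z₀ : Plane) {q : Plane → ℝ} (hq : ContDiff ℝ 1 q) :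
    Continuous (angularDeriv z₀ q) := by
  have := fun i => continuous_pderiv hq i
  unfold angularDeriv
  fun_prop

/-- The point of the plane with polar coordinates `(r, θ)` around `z₀`. -/
noncomputable def polarPoint (z₀ : Plane) (r θ : ℝ) : Plane :=
  z₀ + !₂[r * Real.cos θ, r * Real.sin θ]

lemma continuous_polarPoint (z₀ : Plane) : Continuous fun x : ℝ × ℝ => polarPoint z₀ x.1 x.2 := by
  unfold polarPoint
  fun_prop

lemma norm_polarPoint_sub (z₀ : Plane) {r : ℝ} (θ : ℝ) : ‖polarPoint z₀ r θ - z₀‖ ^ 2 = r ^ 2 := by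
  rw [EuclideanSpace.real_norm_sq_eq]
  simp only [polarPoint, add_sub_cancel_left, Fin.sum_univ_two]
  simp only [Matrix.cons_val_zero, Matrix.cons_val_one]
  linear_combination r ^ 2 * Real.cos_sq_add_sin_sq θ

lemma integrableOn_mul_comp_polarPoint (z₀ : Plane) {f : Plane → ℝ} (hf : Continuous f)
    (hc : HasCompactSupport f) :
    IntegrableOn (fun x : ℝ × ℝ => x.1 * f (polarPoint z₀ x.1 x.2))
      (Ioi 0 ×ˢ Ioo (-Real.pi) Real.pi) := by
  obtain ⟨R, hR⟩ := hc.isCompact.isBounded.subset_closedBall z₀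
  have hvanish : ∀ r θ, R < r → 0 < r → f (polarPoint z₀ r θ) = 0 := by
    intro r θ hRr hr
    by_contra hne
    have h1 := hR (subset_tsupport f hne)
    rw [mem_closedBall_iff_norm] at h1
    have h2 := norm_polarPoint_sub z₀ (r := r) θ
    have h3 : ‖polarPoint z₀ r θ - z₀‖ = r := by
      rwa [sq_eq_sq₀ (norm_nonneg _) hr.le] at h2
    linarith
  have hcont : Continuous fun x : ℝ × ℝ => x.1 * f (polarPoint z₀ x.1 x.2) :=
    continuous_fst.mul (hf.comp (continuous_polarPoint z₀))
  have hK : IntegrableOn (fun x : ℝ × ℝ => x.1 * f (polarPoint z₀ x.1 x.2))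
      (Icc 0 R ×ˢ Icc (-Real.pi) Real.pi) :=
    hcont.continuousOn.integrableOn_compact (isCompact_Icc.prod isCompact_Icc)
  refine hK.of_forall_sdiff_eq_zero (measurableSet_Ioi.prod measurableSet_Ioo) ?_
  rintro ⟨r, θ⟩ ⟨⟨hr, hθ⟩, hx⟩
  simp only [mem_Ioi] at hr
  have : R < r := by
    by_contra hle
    exact hx ⟨⟨hr.le, not_lt.1 hle⟩, Ioo_subset_Icc_self hθ⟩
  simp [hvanish r θ this hr]

lemma integral_eq_integral_polarPoint (z₀ : Plane) {f : Plane → ℝ} (hf : Continuous f)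
    (hc : HasCompactSupport f) :
    ∫ z, f z = ∫ r in Ioi (0 : ℝ), r * ∫ θ in (-Real.pi)..Real.pi, f (polarPoint z₀ r θ) := by
  have h1 : ∫ z, f z = ∫ z, f (z₀ + z) := (integral_add_left_eq_self f z₀).symm
  have h2 : ∫ z, f (z₀ + z) = ∫ x : ℝ × ℝ, f (z₀ + !₂[x.1, x.2]) := by
    have e1 := (PiLp.volume_preserving_toLp (Fin 2)).integral_comp
      (MeasurableEquiv.toLp 2 (Fin 2 → ℝ)).measurableEmbedding (fun z => f (z₀ + z))
    have e2 := (volume_preserving_finTwoArrow ℝ).symm.integral_comp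
      (MeasurableEquiv.finTwoArrow (α := ℝ)).symm.measurableEmbedding
      (fun y => f (z₀ + WithLp.toLp 2 y))
    rw [← e1, ← e2]
    rfl
  have hint := integrableOn_mul_comp_polarPoint z₀ hf hc
  rw [h1, h2, ← integral_comp_polarCoord_symm]
  rw [Measure.volume_eq_prod] at hint ⊢
  change ∫ x in Ioi 0 ×ˢ Ioo (-Real.pi) Real.pi, x.1 * f (polarPoint z₀ x.1 x.2)
    ∂(volume.prod volume) = _
  rw [setIntegral_prod _ hint]
  refine setIntegral_congr_fun measurableSet_Ioi fun r _ => ?_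
  simp only
  rw [integral_const_mul, intervalIntegral.integral_of_le (by linarith [Real.pi_pos]),
    integral_Ioc_eq_integral_Ioo]

lemma hasDerivAt_comp_polarPoint (z₀ : Plane) {q : Plane → ℝ} (hq : ContDiff ℝ 1 q) (r θ : ℝ) :
    HasDerivAt (fun θ => q (polarPoint z₀ r θ)) (angularDeriv z₀ q (polarPoint z₀ r θ)) θ := by
  have h1 : HasDerivAt (fun θ => (polarPoint z₀ r θ)) !₂[-(r * Real.sin θ), r * Real.cos θ] θ := by
    refine HasDerivAt.const_add _ ?_
    have h : HasDerivAt (fun θ => ![r * Real.cos θ, r * Real.sin θ])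
        ![-(r * Real.sin θ), r * Real.cos θ] θ := by
      rw [hasDerivAt_pi]
      intro i
      fin_cases i
      · simpa using (Real.hasDerivAt_cos θ).const_mul r
      · simpa using (Real.hasDerivAt_sin θ).const_mul r
    exact (PiLp.continuousLinearEquiv 2 ℝ (fun _ : Fin 2 => ℝ)).symm.toContinuousLinearMap
      |>.hasFDerivAt.comp_hasDerivAt θ h
  have h2 := (hq.differentiable one_ne_zero (polarPoint z₀ r θ)).hasFDerivAt.comp_hasDerivAt θ h1
  refine h2.congr_deriv ?_
  have hv : (!₂[-(r * Real.sin θ), r * Real.cos θ] : Plane) =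
      (-(r * Real.sin θ)) • EuclideanSpace.single 0 1 +
        (r * Real.cos θ) • EuclideanSpace.single 1 1 := by
    ext i
    fin_cases i <;> simp
  rw [hv, map_add, map_smul, map_smul]
  symm
  simp only [angularDeriv, pderiv, polarPoint, smul_eq_mul]
  simp
  ring

/-- The isoperimetric inequality on all circles around `z₀`, integrated against a radial weight. -/
lemma abs_integral_radial_mul_angularDeriv_le (z₀ : Plane) {ψ : ℝ → ℝ} (hψ : Continuous ψ)
    {p q : Plane → ℝ} (hp : ContDiff ℝ 1 p) (hpc : HasCompactSupport p) (hq : ContDiff ℝ 1 q)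
    (hqc : HasCompactSupport q) :
    |∫ z, ψ (‖z - z₀‖ ^ 2) * (p z * angularDeriv z₀ q z)| ≤
      Real.pi / 4 * ∫ z, |ψ (‖z - z₀‖ ^ 2)| * (angularDeriv z₀ p z ^ 2 + angularDeriv z₀ q z ^ 2) := by
  have hpi := Real.pi_pos
  have cp := continuous_angularDeriv z₀ hp
  have cq := continuous_angularDeriv z₀ hq
  have hpcont := hp.continuous
  have supp : ∀ {f : Plane → ℝ}, HasCompactSupport f → HasCompactSupport (angularDeriv z₀ f) :=
    fun hf => (hasCompactSupport_pderiv hf 1).mul_left.sub (hasCompactSupport_pderiv hf 0).mul_left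
  have supp2 : ∀ {f : Plane → ℝ}, HasCompactSupport f →
      HasCompactSupport (fun z => angularDeriv z₀ f z ^ 2) := by
    intro f hf
    simp only [sq]
    exact (supp hf).mul_left
  set F : Plane → ℝ := fun z => ψ (‖z - z₀‖ ^ 2) * (p z * angularDeriv z₀ q z) with hF
  set H : Plane → ℝ := fun z =>
    |ψ (‖z - z₀‖ ^ 2)| * (angularDeriv z₀ p z ^ 2 + angularDeriv z₀ q z ^ 2) with hH
  have hFc : Continuous F := by fun_prop
  have hHc : Continuous H := by fun_prop
  have hFs : HasCompactSupport F := hpc.mul_right.mul_left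
  have hHs : HasCompactSupport H := ((supp2 hpc).add (supp2 hqc)).mul_left
  have hcirc : ∀ r, |∫ θ in (-Real.pi)..Real.pi, F (polarPoint z₀ r θ)| ≤
      Real.pi / 4 * ∫ θ in (-Real.pi)..Real.pi, H (polarPoint z₀ r θ) := by
    intro r
    simp only [hF, hH, norm_polarPoint_sub]
    rw [intervalIntegral.integral_const_mul, intervalIntegral.integral_const_mul, abs_mul]
    have cpol : Continuous fun θ => polarPoint z₀ r θ :=
      (continuous_polarPoint z₀).comp (Continuous.prodMk_right r)
    have hper : polarPoint z₀ r (-Real.pi) = polarPoint z₀ r Real.pi := by simp [polarPoint]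
    have h := abs_integral_mul_deriv_le (by linarith) (hasDerivAt_comp_polarPoint z₀ hp r)
      (hasDerivAt_comp_polarPoint z₀ hq r) (cp.comp cpol) (cq.comp cpol)
      (congrArg p hper) (congrArg q hper)
    calc _ ≤ |ψ (r ^ 2)| * _ := mul_le_mul_of_nonneg_left h (abs_nonneg _)
      _ = _ := by ring
  have hFH : ∀ {f : Plane → ℝ}, Continuous f → HasCompactSupport f → IntegrableOn
      (fun r => r * ∫ θ in (-Real.pi)..Real.pi, f (polarPoint z₀ r θ)) (Ioi 0) := by
    intro f hf hfc
    have h := integrableOn_mul_comp_polarPoint z₀ hf hfc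
    rw [IntegrableOn, Measure.volume_eq_prod, ← Measure.prod_restrict] at h
    refine h.integral_prod_left.congr (Eventually.of_forall fun r => ?_)
    simp only
    rw [integral_const_mul, intervalIntegral.integral_of_le (by linarith),
      integral_Ioc_eq_integral_Ioo]
  rw [integral_eq_integral_polarPoint z₀ hFc hFs, integral_eq_integral_polarPoint z₀ hHc hHs,
    ← integral_const_mul]
  refine (abs_integral_le_integral_abs).trans ?_
  refine setIntegral_mono_on (hFH hFc hFs).abs ((hFH hHc hHs).const_mul _) measurableSet_Ioi ?_
  intro r hr
  rw [abs_mul, abs_of_pos (mem_Ioi.1 hr)]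
  calc _ ≤ r * _ := mul_le_mul_of_nonneg_left (hcirc r) (mem_Ioi.1 hr).le
    _ = _ := by ring

/-! ### Pointwise consequences of the equation -/

/-- The squared Frobenius norm of the Hessian. -/
noncomputable def hessSq (u : Plane → ℝ) (z : Plane) : ℝ :=
  pderiv 0 (pderiv 0 u) z ^ 2 + 2 * pderiv 1 (pderiv 0 u) z ^ 2 + pderiv 1 (pderiv 1 u) z ^ 2

/-- The negative of the Hessian determinant. -/
noncomputable def negHessDet (u : Plane → ℝ) (z : Plane) : ℝ :=
  pderiv 1 (pderiv 0 u) z ^ 2 - pderiv 0 (pderiv 0 u) z * pderiv 1 (pderiv 1 u) z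

lemma mem_spectrum_symm_two_iff {a b c t : ℝ} :
    t ∈ spectrum ℝ (!![a, b; b, c] : Matrix (Fin 2) (Fin 2) ℝ) ↔ (t - a) * (t - c) = b ^ 2 := by
  rw [spectrum.mem_iff, Matrix.isUnit_iff_isUnit_det, isUnit_iff_ne_zero, not_not,
    Matrix.det_fin_two]
  simp [Matrix.algebraMap_matrix_apply, sub_eq_zero, sq]

lemma trace_and_form_of_eigenvalues {a b c l m : ℝ}
    (hl : IsLeast (spectrum ℝ (!![a, b; b, c] : Matrix (Fin 2) (Fin 2) ℝ)) l)
    (hm : IsGreatest (spectrum ℝ (!![a, b; b, c] : Matrix (Fin 2) (Fin 2) ℝ)) m) :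
    a + c = l + m ∧ l ≤ m ∧
      ∀ x y : ℝ, l * (x ^ 2 + y ^ 2) ≤ a * x ^ 2 + 2 * b * x * y + c * y ^ 2 := by
  have h1 := mem_spectrum_symm_two_iff.1 hl.1
  have h2 := mem_spectrum_symm_two_iff.1 hm.1
  have h3 : a + c - l ∈ spectrum ℝ (!![a, b; b, c] : Matrix (Fin 2) (Fin 2) ℝ) :=
    mem_spectrum_symm_two_iff.2 (by linear_combination h1)
  have h4 := hl.2 h3
  have h5 := hm.2 h3
  have h6 := hl.2 hm.1
  have hac : a + c = l + m := by
    have : (m - l) * (m - (a + c - l)) = 0 := by linear_combination h2 - h1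
    rcases mul_eq_zero.1 this with h | h <;> linarith
  refine ⟨hac, h6, fun x y => ?_⟩
  rcases (show 0 ≤ (a - l) + (c - l) by linarith).eq_or_lt with h | h
  · have ha : a = l := by nlinarith [sq_nonneg b, sq_nonneg (a - l)]
    have hc : c = l := by linarith
    have hb : b = 0 := by
      rw [ha, hc] at h1
      simpa using h1.symm
    rw [ha, hb, hc]
    nlinarith
  · have key : ((a - l) + (c - l)) * ((a - l) * x ^ 2 + 2 * b * x * y + (c - l) * y ^ 2) =
        ((a - l) * x + b * y) ^ 2 + (b * x + (c - l) * y) ^ 2 := by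
      linear_combination (x ^ 2 + y ^ 2) * h1
    have : 0 ≤ (a - l) * x ^ 2 + 2 * b * x * y + (c - l) * y ^ 2 := by
      refine nonneg_of_mul_nonneg_right ?_ h
      rw [key]
      positivity
    linarith

/-- Multiplying the equation by `u_xx` and by `u_yy` and adding gives
`λ |D²u|² ≤ (λ + Λ) (u_xy² - u_xx u_yy) + f Δu`. Where the Jacobian is negative, the ratio `Λ / λ`
cannot be replaced by `γ`; there the Hessian is controlled by `f / λ` alone. -/
lemma sq_sum_le_of_equation {a b c l m f γ X Y Z : ℝ}
    (hl : IsLeast (spectrum ℝ (!![a, b; b, c] : Matrix (Fin 2) (Fin 2) ℝ)) l)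
    (hm : IsGreatest (spectrum ℝ (!![a, b; b, c] : Matrix (Fin 2) (Fin 2) ℝ)) m)
    (hl0 : 0 < l) (hγ : m / l ≤ γ) (heq : a * X + 2 * b * Y + c * Z = f) :
    X ^ 2 + 2 * Y ^ 2 + Z ^ 2 ≤
      10 / 9 * (1 + γ) * (Y ^ 2 - X * Z) + (7 + γ) * (f / l) ^ 2 := by
  obtain ⟨hac, hlm, hform⟩ := trace_and_form_of_eigenvalues hl hm
  obtain ⟨g, rfl⟩ : ∃ g, f = l * g := ⟨f / l, by field_simp⟩
  obtain ⟨k, rfl⟩ : ∃ k, m = l * k := ⟨m / l, by field_simp⟩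
  have hgl : l * g / l = g := by field_simp
  have hkl : l * k / l = k := by field_simp
  rw [hgl]
  rw [hkl] at hγ
  have hk1 : 1 ≤ k := by
    by_contra h
    nlinarith
  have h1 := hform X Y
  have h2 := hform Y Z
  have hmain : X ^ 2 + 2 * Y ^ 2 + Z ^ 2 ≤ (1 + k) * (Y ^ 2 - X * Z) + g * (X + Z) := by
    refine le_of_mul_le_mul_left ?_ hl0
    have e : a * X ^ 2 + 2 * b * X * Y + c * Y ^ 2 + (a * Y ^ 2 + 2 * b * Y * Z + c * Z ^ 2) =
        l * ((1 + k) * (Y ^ 2 - X * Z) + g * (X + Z)) := by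
      linear_combination (X + Z) * heq + (Y ^ 2 - X * Z) * hac
    linarith
  rcases le_or_gt 0 (Y ^ 2 - X * Z) with hJ | hJ
  · have h3 : (1 + k) * (Y ^ 2 - X * Z) ≤ (1 + γ) * (Y ^ 2 - X * Z) :=
      mul_le_mul_of_nonneg_right (by linarith) hJ
    -- Absorbing a tenth of the Hessian turns `1 + γ` into `10 / 9 * (1 + γ)`.
    have h4 : g * (X + Z) ≤ 1 / 10 * (X ^ 2 + 2 * Y ^ 2 + Z ^ 2) + 5 * g ^ 2 := by
      nlinarith [sq_nonneg (X / 10 - g / 2), sq_nonneg (Z - 5 * g), sq_nonneg (X - 5 * g),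
        sq_nonneg Y]
    nlinarith [sq_nonneg g]
  · have h3 : (1 + k) * (Y ^ 2 - X * Z) ≤ 2 * (Y ^ 2 - X * Z) := by nlinarith
    -- Here `(X + Z) ^ 2 ≤ g * (X + Z)`, so `g` dominates the trace of the Hessian.
    have h4 : (X + Z) ^ 2 ≤ g * (X + Z) := by nlinarith
    have h5 : g * (X + Z) ≤ g ^ 2 := by nlinarith [sq_nonneg (X + Z - g)]
    have h6 : X ^ 2 + 2 * Y ^ 2 + Z ^ 2 - 2 * (Y ^ 2 - X * Z) ≤ g ^ 2 := by nlinarith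
    have h7 : 0 ≤ X ^ 2 + 2 * Y ^ 2 + Z ^ 2 := by positivity
    have h8 : - (Y ^ 2 - X * Z) ≤ g ^ 2 / 2 := by linarith
    have h9 : 10 / 9 * (1 + γ) * (-(Y ^ 2 - X * Z)) ≤ 10 / 9 * (1 + γ) * (g ^ 2 / 2) :=
      mul_le_mul_of_nonneg_left h8 (by linarith)
    nlinarith [sq_nonneg g]

lemma hessSq_le_of_equation {Ω : Set Plane} {a b c f l m u : Plane → ℝ} {γ : ℝ}
    (heq : ∀ z ∈ Ω, ellipticOp a b c u z = f z) (heig : AreEigenvalues Ω a b c l m)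
    (hl0 : ∀ z ∈ Ω, 0 < l z) (hγ : ∀ z ∈ Ω, m z / l z ≤ γ) {z : Plane} (hz : z ∈ Ω) :
    hessSq u z ≤ 10 / 9 * (1 + γ) * negHessDet u z + (7 + γ) * (f z / l z) ^ 2 :=
  sq_sum_le_of_equation (heig z hz).1 (heig z hz).2 (hl0 z hz) (hγ z hz) (heq z hz)

lemma holderExp_mem_Ioo {γ : ℝ} (hγ : 1 ≤ γ) : holderExp γ ∈ Ioo (0 : ℝ) 1 := by
  unfold holderExp
  have h1 : Real.sqrt (γ ^ 2 + 2 * γ) < 1 + γ := by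
    rw [Real.sqrt_lt' (by linarith)]
    nlinarith
  have h2 : γ < Real.sqrt (γ ^ 2 + 2 * γ) := Real.lt_sqrt_of_sq_lt (by linarith)
  constructor <;> linarith

/-- The exponent is well below the critical one for the differential inequality with the constant
`10 / 9 * (1 + γ)`; the room to spare pays for the constant in the isoperimetric inequality. -/
lemma mul_holderExp_le {γ : ℝ} (hγ : 1 ≤ γ) : 10 / 9 * (1 + γ) * holderExp γ ≤ 3 / 5 := by
  unfold holderExp
  set s := Real.sqrt (γ ^ 2 + 2 * γ)
  have hs : s ^ 2 = γ ^ 2 + 2 * γ := Real.sq_sqrt (by nlinarith)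
  have hs0 : 0 ≤ s := Real.sqrt_nonneg _
  have h1 : 23 / 50 * (1 + γ) ≤ s - 2 / 5 * (1 + γ) := by
    have : 43 / 50 * (1 + γ) ≤ s := Real.le_sqrt_of_sq_le (by nlinarith)
    linarith
  have h2 : (1 + γ - s) * (1 + γ + s) = 1 := by linear_combination -hs
  have h3 : 0 < 1 + γ + s := by linarith
  have h4 : 1 + γ - s = 1 / (1 + γ + s) := by field_simp; linarith
  rw [h4, mul_one_div, div_le_iff₀ h3]
  linarith

/-! ### Radial weights -/

/-- The truncation `(1 - |z - z₀|² / R²)₊` as a function of `t = |z - z₀|²`. -/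
noncomputable def cutProfile (R t : ℝ) : ℝ := max (1 - t / R ^ 2) 0

lemma cutProfile_nonneg (R t : ℝ) : 0 ≤ cutProfile R t := le_max_right _ _

lemma cutProfile_le_one {R t : ℝ} (ht : 0 ≤ t) : cutProfile R t ≤ 1 :=
  max_le (by have : 0 ≤ t / R ^ 2 := by positivity
             linarith) zero_le_one

lemma continuous_cutProfile (R : ℝ) : Continuous (cutProfile R) := by
  unfold cutProfile
  fun_prop

lemma cutProfile_eq_zero {R : ℝ} (hR : 0 < R) {z₀ z : Plane} (hz : z ∉ Metric.ball z₀ R) :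
    cutProfile R (‖z - z₀‖ ^ 2) = 0 := by
  rw [mem_ball_iff_norm, not_lt] at hz
  refine max_eq_right (sub_nonpos.2 ?_)
  rw [one_le_div (by positivity)]
  exact pow_le_pow_left₀ hR.le hz 2

lemma three_quarters_le_cutProfile {R : ℝ} (hR : 0 < R) {z₀ z : Plane}
    (hz : z ∈ Metric.ball z₀ (R / 2)) : 3 / 4 ≤ cutProfile R (‖z - z₀‖ ^ 2) := by
  rw [mem_ball_iff_norm] at hz
  refine le_max_of_le_left ?_
  have : ‖z - z₀‖ ^ 2 / R ^ 2 ≤ 1 / 4 := by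
    rw [div_le_iff₀ (by positivity)]
    nlinarith [norm_nonneg (z - z₀)]
  linarith

lemma hasDerivAt_max_zero_sq (s : ℝ) : HasDerivAt (fun s : ℝ => max s 0 ^ 2) (2 * max s 0) s := by
  rcases lt_trichotomy s 0 with h | rfl | h
  · rw [max_eq_right h.le, mul_zero]
    refine (hasDerivAt_const s (0 : ℝ)).congr_of_eventuallyEq ?_
    filter_upwards [gt_mem_nhds h] with x hx
    rw [max_eq_right hx.le]
    simp
  · rw [hasDerivAt_iff_isLittleO_nhds_zero]
    have h2 : (fun h : ℝ => h ^ 2) =o[𝓝 0] fun h => h := by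
      simpa using Asymptotics.isLittleO_pow_id (𝕜 := ℝ) one_lt_two
    refine (Asymptotics.IsBigO.of_bound 1 ?_).trans_isLittleO h2
    filter_upwards with x
    simp only [zero_add, max_self, mul_zero, smul_zero, sub_zero, one_mul, Real.norm_eq_abs,
      ne_eq, OfNat.ofNat_ne_zero, not_false_eq_true, zero_pow, abs_pow]
    refine pow_le_pow_left₀ (abs_nonneg _) ?_ 2
    rcases le_total x 0 with h | h
    · simp [max_eq_right h]
    · simp [max_eq_left h]
  · rw [max_eq_left h.le]
    have h1 := hasDerivAt_pow 2 s
    simp only [Nat.cast_ofNat, Nat.add_one_sub_one, pow_one] at h1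
    refine h1.congr_of_eventuallyEq ?_
    filter_upwards [lt_mem_nhds h] with x hx
    rw [max_eq_left hx.le]

lemma hasDerivAt_cutProfile_sq (R t : ℝ) :
    HasDerivAt (fun t => cutProfile R t ^ 2) (-(2 / R ^ 2) * cutProfile R t) t := by
  have h1 : HasDerivAt (fun t : ℝ => 1 - t / R ^ 2) (-(1 / R ^ 2)) t := by
    simpa using ((hasDerivAt_id t).div_const (R ^ 2)).const_sub 1
  refine ((hasDerivAt_max_zero_sq _).comp t h1).congr_deriv ?_
  unfold cutProfile
  ring

lemma hasFDerivAt_radial {φ ψ : ℝ → ℝ} (hφ : ∀ t, 0 ≤ t → HasDerivAt φ (ψ t) t) (z₀ z : Plane) :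
    HasFDerivAt (fun z => φ (‖z - z₀‖ ^ 2))
      (ψ (‖z - z₀‖ ^ 2) • (2 : ℝ) • innerSL ℝ (z - z₀)) z := by
  have h1 : HasFDerivAt (fun z : Plane => ‖z - z₀‖ ^ 2) ((2 : ℝ) • innerSL ℝ (z - z₀)) z := by
    have := ((hasFDerivAt_id z).sub_const z₀).norm_sq
    refine this.congr_fderiv ?_
    ext v
    simp
  exact (hφ _ (by positivity)).comp_hasFDerivAt z h1

lemma contDiff_radial {φ ψ : ℝ → ℝ} (hφ : ∀ t, 0 ≤ t → HasDerivAt φ (ψ t) t) (hψ : Continuous ψ)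
    (z₀ : Plane) : ContDiff ℝ 1 (fun z => φ (‖z - z₀‖ ^ 2)) := by
  rw [contDiff_one_iff_fderiv]
  refine ⟨fun z => (hasFDerivAt_radial hφ z₀ z).differentiableAt, ?_⟩
  rw [show fderiv ℝ (fun z => φ (‖z - z₀‖ ^ 2)) = _ from
    funext fun z => (hasFDerivAt_radial hφ z₀ z).fderiv]
  fun_prop

lemma pderiv_radial {φ ψ : ℝ → ℝ} (hφ : ∀ t, 0 ≤ t → HasDerivAt φ (ψ t) t) (z₀ : Plane) (i : Fin 2)
    (z : Plane) :
    pderiv i (fun z => φ (‖z - z₀‖ ^ 2)) z = 2 * ψ (‖z - z₀‖ ^ 2) * (z i - z₀ i) := by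
  unfold pderiv
  rw [(hasFDerivAt_radial hφ z₀ z).fderiv]
  simp [EuclideanSpace.inner_single_right]
  ring

lemma continuous_pderiv_pderiv {u : Plane → ℝ} (hu : ContDiff ℝ 2 u) (i j : Fin 2) :
    Continuous (pderiv i (pderiv j u)) :=
  continuous_pderiv (contDiff_pderiv (n := 1) (by norm_num; exact hu) j) i

lemma continuous_hessSq {u : Plane → ℝ} (hu : ContDiff ℝ 2 u) : Continuous (hessSq u) := by
  have := continuous_pderiv_pderiv hu
  unfold hessSq
  fun_prop

lemma continuous_negHessDet {u : Plane → ℝ} (hu : ContDiff ℝ 2 u) : Continuous (negHessDet u) := by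
  have := continuous_pderiv_pderiv hu
  unfold negHessDet
  fun_prop

lemma hasCompactSupport_pderiv_pderiv {u : Plane → ℝ} (hc : HasCompactSupport u) (i j : Fin 2) :
    HasCompactSupport (pderiv i (pderiv j u)) :=
  hasCompactSupport_pderiv (hasCompactSupport_pderiv hc j) i

lemma hasCompactSupport_hessSq {u : Plane → ℝ} (hc : HasCompactSupport u) :
    HasCompactSupport (hessSq u) := by
  have h := hasCompactSupport_pderiv_pderiv hc
  unfold hessSq
  simp only [sq]
  exact ((h 0 0).mul_left.add (h 1 0).mul_left.mul_left).add (h 1 1).mul_left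

lemma hasCompactSupport_negHessDet {u : Plane → ℝ} (hc : HasCompactSupport u) :
    HasCompactSupport (negHessDet u) := by
  have h := hasCompactSupport_pderiv_pderiv hc
  unfold negHessDet
  simp only [sq]
  exact (h 1 0).mul_left.sub (h 0 0).mul_right

lemma hessSq_nonneg (u : Plane → ℝ) (z : Plane) : 0 ≤ hessSq u z := by
  unfold hessSq
  positivity

lemma norm_sub_sq (z z₀ : Plane) : ‖z - z₀‖ ^ 2 = (z 0 - z₀ 0) ^ 2 + (z 1 - z₀ 1) ^ 2 := by
  rw [EuclideanSpace.real_norm_sq_eq]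
  simp [Fin.sum_univ_two]

/-- With a radial weight, the integral of the Jacobian only sees the angular derivative. -/
lemma integral_radial_mul_negHessDet {φ ψ : ℝ → ℝ} (hφ : ∀ t, 0 ≤ t → HasDerivAt φ (ψ t) t)
    (hψ : Continuous ψ) (z₀ : Plane) {u : Plane → ℝ} (hu : ContDiff ℝ 2 u)
    (hc : HasCompactSupport u) :
    ∫ z, φ (‖z - z₀‖ ^ 2) * negHessDet u z =
      ∫ z, 2 * ψ (‖z - z₀‖ ^ 2) * (pderiv 0 u z * angularDeriv z₀ (pderiv 1 u) z) := by
  have hu' : ContDiff ℝ (1 + 1) u := by norm_num; exact hu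
  have h := integral_weight_mul_jacobian (contDiff_radial hφ hψ z₀) (contDiff_pderiv hu' 0)
    (hasCompactSupport_pderiv hc 0) (contDiff_pderiv hu' 1) (hasCompactSupport_pderiv hc 1)
  refine Eq.trans ?_ (h.trans ?_)
  · congr 1
    ext z
    rw [negHessDet, pderiv_comm hu 0 1]
    ring
  · congr 1
    ext z
    rw [pderiv_radial hφ, pderiv_radial hφ, angularDeriv]
    ring

lemma angularDeriv_sq_add_le {u : Plane → ℝ} (hu : ContDiff ℝ 2 u) (z₀ z : Plane) :
    angularDeriv z₀ (pderiv 0 u) z ^ 2 + angularDeriv z₀ (pderiv 1 u) z ^ 2 ≤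
      ‖z - z₀‖ ^ 2 * hessSq u z := by
  rw [norm_sub_sq, hessSq, angularDeriv, angularDeriv, pderiv_comm hu 0 1]
  set x := z 0 - z₀ 0
  set y := z 1 - z₀ 1
  set X := pderiv 0 (pderiv 0 u) z
  set Y := pderiv 1 (pderiv 0 u) z
  set Z := pderiv 1 (pderiv 1 u) z
  nlinarith [sq_nonneg (x * X + y * Y), sq_nonneg (x * Y + y * Z)]

lemma abs_integral_radial_mul_negHessDet_le {φ ψ : ℝ → ℝ}
    (hφ : ∀ t, 0 ≤ t → HasDerivAt φ (ψ t) t) (hψ : Continuous ψ) (z₀ : Plane) {u : Plane → ℝ}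
    (hu : ContDiff ℝ 2 u) (hc : HasCompactSupport u) :
    |∫ z, φ (‖z - z₀‖ ^ 2) * negHessDet u z| ≤
      Real.pi / 2 * ∫ z, |ψ (‖z - z₀‖ ^ 2)| * ‖z - z₀‖ ^ 2 * hessSq u z := by
  have hu' : ContDiff ℝ (1 + 1) u := by norm_num; exact hu
  rw [integral_radial_mul_negHessDet hφ hψ z₀ hu hc]
  simp only [mul_assoc]
  rw [integral_const_mul, abs_mul, abs_of_pos (two_pos : (0 : ℝ) < 2)]
  have h := abs_integral_radial_mul_angularDeriv_le z₀ hψ (contDiff_pderiv hu' 0)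
    (hasCompactSupport_pderiv hc 0) (contDiff_pderiv hu' 1) (hasCompactSupport_pderiv hc 1)
  have hint : Integrable fun z => |ψ (‖z - z₀‖ ^ 2)| * (‖z - z₀‖ ^ 2 * hessSq u z) := by
    refine Continuous.integrable_of_hasCompactSupport ?_
      ((hasCompactSupport_hessSq hc).mul_left.mul_left)
    have := continuous_hessSq hu
    fun_prop
  have h2 : ∫ z, |ψ (‖z - z₀‖ ^ 2)| *
      (angularDeriv z₀ (pderiv 0 u) z ^ 2 + angularDeriv z₀ (pderiv 1 u) z ^ 2) ≤
      ∫ z, |ψ (‖z - z₀‖ ^ 2)| * (‖z - z₀‖ ^ 2 * hessSq u z) := by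
    refine integral_mono_of_nonneg (Eventually.of_forall fun z => ?_) hint
      (Eventually.of_forall fun z => ?_)
    · simp only [Pi.zero_apply]
      positivity
    · exact mul_le_mul_of_nonneg_left (angularDeriv_sq_add_le hu z₀ z) (abs_nonneg _)
  nlinarith [Real.pi_pos]

/-- The pointwise inequality for the Hessian, integrated against a weight supported in a ball. -/
lemma integral_weight_mul_hessSq_le {K R : ℝ} {z₀ : Plane} {u k G : Plane → ℝ}
    (hu : ContDiff ℝ 2 u) (hc : HasCompactSupport u) (hG : Continuous G) (hG0 : ∀ z, 0 ≤ G z)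
    (hGz : ∀ z, z ∉ Metric.ball z₀ R → G z = 0)
    (hH : ∀ z ∈ Metric.ball z₀ R, hessSq u z ≤ K * negHessDet u z + k z)
    (hk : IntegrableOn (fun z => G z * k z) (Metric.ball z₀ R)) :
    ∫ z, G z * hessSq u z ≤
      K * (∫ z, G z * negHessDet u z) + ∫ z in Metric.ball z₀ R, G z * k z := by
  have hi1 : Integrable fun z => G z * hessSq u z :=
    (hG.mul (continuous_hessSq hu)).integrable_of_hasCompactSupport
      (hasCompactSupport_hessSq hc).mul_left
  have hi2 : Integrable fun z => G z * negHessDet u z :=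
    (hG.mul (continuous_negHessDet hu)).integrable_of_hasCompactSupport
      (hasCompactSupport_negHessDet hc).mul_left
  rw [← setIntegral_eq_integral_of_forall_compl_eq_zero (s := Metric.ball z₀ R)
      (f := fun z => G z * hessSq u z) fun z hz => by simp [hGz z hz],
    ← setIntegral_eq_integral_of_forall_compl_eq_zero (s := Metric.ball z₀ R)
      (f := fun z => G z * negHessDet u z) fun z hz => by simp [hGz z hz],
    ← integral_const_mul, ← integral_add (hi2.integrableOn.const_mul K) hk]
  refine setIntegral_mono_on hi1.integrableOn ((hi2.integrableOn.const_mul K).add hk)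
    measurableSet_ball fun z hz => ?_
  have := mul_le_mul_of_nonneg_left (hH z hz) (hG0 z)
  linarith

/-! ### Energy estimates -/

lemma volume_real_ball {R : ℝ} (hR : 0 ≤ R) (z₀ : Plane) :
    volume.real (Metric.ball z₀ R) = Real.pi * R ^ 2 := by
  rw [Measure.real, EuclideanSpace.volume_ball_fin_two, ENNReal.toReal_mul, ENNReal.toReal_pow,
    ENNReal.toReal_ofReal hR]
  simp [mul_comm, Real.pi_nonneg]

/-- Testing with `η² u Du`, where `η` is the truncation of the ball, bounds the gradient by the
function and a small multiple of the Hessian. -/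
lemma integral_cut_sq_mul_gradSq_le {δ R S : ℝ} (hδ : 0 < δ) (hR : 0 < R) {z₀ : Plane}
    {u : Plane → ℝ} (hu : ContDiff ℝ 2 u) (hc : HasCompactSupport u)
    (hS : ∀ z ∈ Metric.ball z₀ R, |u z| ≤ S) :
    ∫ z, cutProfile R (‖z - z₀‖ ^ 2) ^ 2 * (pderiv 0 u z ^ 2 + pderiv 1 u z ^ 2) ≤
      2 * δ * (∫ z, (cutProfile R (‖z - z₀‖ ^ 2) ^ 2) ^ 2 * hessSq u z) +
        (1 / δ + 16 / R ^ 2) * S ^ 2 * (Real.pi * R ^ 2) := by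
  have hu' : ContDiff ℝ (1 + 1) u := by norm_num; exact hu
  have hu1 : ContDiff ℝ 1 u := hu.of_le (by norm_num)
  set η : Plane → ℝ := fun z => cutProfile R (‖z - z₀‖ ^ 2) with hη
  have hηc : Continuous η := (continuous_cutProfile R).comp (by fun_prop)
  have hη0 : ∀ z, z ∉ Metric.ball z₀ R → η z = 0 := fun z hz => cutProfile_eq_zero hR hz
  have hψc : Continuous fun t => -(2 / R ^ 2) * cutProfile R t :=
    continuous_const.mul (continuous_cutProfile R)
  have hη2 : ContDiff ℝ 1 (fun z => η z ^ 2) :=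
    contDiff_radial (fun t _ => hasDerivAt_cutProfile_sq R t) hψc z₀
  have hη2d : ∀ i z, pderiv i (fun z => η z ^ 2) z =
      2 * (-(2 / R ^ 2) * η z) * (z i - z₀ i) := fun i z =>
    pderiv_radial (fun t _ => hasDerivAt_cutProfile_sq R t) z₀ i z
  have hp := fun i => contDiff_pderiv hu' i
  have cu := hu.continuous
  have cp := fun i => (hp i).continuous
  have cpp := continuous_pderiv_pderiv hu
  have cH := continuous_hessSq hu
  -- The divergence of the compactly supported field `η² u Du` has integral zero.
  have hdiv : ∀ i, ∫ z, (η z ^ 2 * (u z * pderiv i (pderiv i u) z + pderiv i u z ^ 2) +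
      u z * pderiv i u z * (2 * (-(2 / R ^ 2) * η z) * (z i - z₀ i))) = 0 := by
    intro i
    have h := integral_pderiv_eq_zero (f := fun z => η z ^ 2 * (u z * pderiv i u z))
      (hη2.mul (hu1.mul (hp i))) hc.mul_right.mul_left i
    rw [← h]
    congr 1
    ext z
    rw [pderiv_mul hη2 (hu1.mul (hp i)), pderiv_mul hu1 (hp i), hη2d]
    ring
  have hint : ∀ i, Integrable fun z =>
      (η z ^ 2 * (u z * pderiv i (pderiv i u) z + pderiv i u z ^ 2) +
      u z * pderiv i u z * (2 * (-(2 / R ^ 2) * η z) * (z i - z₀ i))) := by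
    intro i
    refine Continuous.integrable_of_hasCompactSupport (by fun_prop) ?_
    have h1 := hasCompactSupport_pderiv hc i
    simp only [sq]
    exact (hc.mul_right.add h1.mul_left).mul_left.add hc.mul_right.mul_right
  have hint' : Integrable fun z =>
      ((η z ^ 2 * (u z * pderiv 0 (pderiv 0 u) z + pderiv 0 u z ^ 2) +
        u z * pderiv 0 u z * (2 * (-(2 / R ^ 2) * η z) * (z 0 - z₀ 0))) +
        (η z ^ 2 * (u z * pderiv 1 (pderiv 1 u) z + pderiv 1 u z ^ 2) +
        u z * pderiv 1 u z * (2 * (-(2 / R ^ 2) * η z) * (z 1 - z₀ 1)))) :=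
    (hint 0).add (hint 1)
  have hsum : ∫ z,
      ((η z ^ 2 * (u z * pderiv 0 (pderiv 0 u) z + pderiv 0 u z ^ 2) +
        u z * pderiv 0 u z * (2 * (-(2 / R ^ 2) * η z) * (z 0 - z₀ 0))) +
        (η z ^ 2 * (u z * pderiv 1 (pderiv 1 u) z + pderiv 1 u z ^ 2) +
        u z * pderiv 1 u z * (2 * (-(2 / R ^ 2) * η z) * (z 1 - z₀ 1)))) = 0 := by
    rw [integral_add (hint 0) (hint 1), hdiv, hdiv, add_zero]
  have hi1 : Integrable fun z => η z ^ 2 * (pderiv 0 u z ^ 2 + pderiv 1 u z ^ 2) := by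
    refine Continuous.integrable_of_hasCompactSupport (by fun_prop) ?_
    have h1 := hasCompactSupport_pderiv hc
    simp only [sq]
    exact ((h1 0).mul_left.add (h1 1).mul_left).mul_left
  have hi2 : Integrable fun z => (η z ^ 2) ^ 2 * hessSq u z :=
    Continuous.integrable_of_hasCompactSupport (by fun_prop) (hasCompactSupport_hessSq hc).mul_left
  have hvanish : ∀ {f : Plane → ℝ}, (∀ z, η z = 0 → f z = 0) →
      ∫ z, f z = ∫ z in Metric.ball z₀ R, f z := fun hf =>
    (setIntegral_eq_integral_of_forall_compl_eq_zero fun z hz => hf z (hη0 z hz)).symm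
  have hmono : ∫ z in Metric.ball z₀ R, (1 / 2 * (η z ^ 2 * (pderiv 0 u z ^ 2 + pderiv 1 u z ^ 2)))
      ≤ ∫ z in Metric.ball z₀ R, (((η z ^ 2 * (u z * pderiv 0 (pderiv 0 u) z + pderiv 0 u z ^ 2) +
        u z * pderiv 0 u z * (2 * (-(2 / R ^ 2) * η z) * (z 0 - z₀ 0))) +
        (η z ^ 2 * (u z * pderiv 1 (pderiv 1 u) z + pderiv 1 u z ^ 2) +
        u z * pderiv 1 u z * (2 * (-(2 / R ^ 2) * η z) * (z 1 - z₀ 1)))) +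
        (δ * ((η z ^ 2) ^ 2 * hessSq u z) + (1 / (2 * δ) + 8 / R ^ 2) * S ^ 2)) := by
    refine setIntegral_mono_on (hi1.const_mul _).integrableOn ?_ measurableSet_ball fun z hz => ?_
    · refine IntegrableOn.add hint'.integrableOn ?_
      exact (hi2.const_mul δ).integrableOn.add (integrableOn_const measure_ball_lt_top.ne)
    · have hu2 : u z ^ 2 ≤ S ^ 2 := by
        rw [← sq_abs]
        exact pow_le_pow_left₀ (abs_nonneg _) (hS z hz) 2
      have hρ : (z 0 - z₀ 0) ^ 2 + (z 1 - z₀ 1) ^ 2 ≤ R ^ 2 := by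
        rw [← norm_sub_sq]
        exact pow_le_pow_left₀ (norm_nonneg _) (mem_ball_iff_norm.1 hz).le 2
      rw [hessSq]
      generalize pderiv 0 (pderiv 0 u) z = X
      generalize pderiv 1 (pderiv 0 u) z = Y
      generalize pderiv 1 (pderiv 1 u) z = Z
      generalize pderiv 0 u z = p
      generalize pderiv 1 u z = q
      generalize η z = e
      generalize z 0 - z₀ 0 = x at *
      generalize z 1 - z₀ 1 = y at *
      generalize u z = v at *
      have h1 : -(e ^ 2 * v * (X + Z)) ≤
          δ * ((e ^ 2) ^ 2 * (X ^ 2 + 2 * Y ^ 2 + Z ^ 2)) + 1 / (2 * δ) * S ^ 2 := by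
        have ha : -(e ^ 2 * v * X) ≤ δ * ((e ^ 2) ^ 2 * X ^ 2) + 1 / (4 * δ) * v ^ 2 := by
          have : δ * ((e ^ 2) ^ 2 * X ^ 2) + 1 / (4 * δ) * v ^ 2 + e ^ 2 * v * X =
            1 / (4 * δ) * (2 * δ * e ^ 2 * X + v) ^ 2 := by field_simp; ring
          have h0 : 0 ≤ 1 / (4 * δ) * (2 * δ * e ^ 2 * X + v) ^ 2 := by positivity
          linarith
        have hb : -(e ^ 2 * v * Z) ≤ δ * ((e ^ 2) ^ 2 * Z ^ 2) + 1 / (4 * δ) * v ^ 2 := by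
          have : δ * ((e ^ 2) ^ 2 * Z ^ 2) + 1 / (4 * δ) * v ^ 2 + e ^ 2 * v * Z =
            1 / (4 * δ) * (2 * δ * e ^ 2 * Z + v) ^ 2 := by field_simp; ring
          have h0 : 0 ≤ 1 / (4 * δ) * (2 * δ * e ^ 2 * Z + v) ^ 2 := by positivity
          linarith
        have hc : 1 / (4 * δ) * v ^ 2 ≤ 1 / (4 * δ) * S ^ 2 :=
          mul_le_mul_of_nonneg_left hu2 (by positivity)
        have hd : 0 ≤ δ * ((e ^ 2) ^ 2 * Y ^ 2) := by positivity
        have he : 1 / (2 * δ) * S ^ 2 = 1 / (4 * δ) * S ^ 2 + 1 / (4 * δ) * S ^ 2 := by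
          field_simp; ring
        rw [he]
        linarith
      have h2 : (4 / R ^ 2) * (e * v * (p * x + q * y)) ≤
          1 / 2 * (e ^ 2 * (p ^ 2 + q ^ 2)) + 8 / R ^ 2 * S ^ 2 := by
        have ha : (4 / R ^ 2) * (e * v * (p * x + q * y)) ≤
            1 / 2 * (e ^ 2 * (p ^ 2 + q ^ 2)) + 8 / R ^ 4 * (v ^ 2 * (x ^ 2 + y ^ 2)) := by
          have : 1 / 2 * (e ^ 2 * (p ^ 2 + q ^ 2)) + 8 / R ^ 4 * (v ^ 2 * (x ^ 2 + y ^ 2)) -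
              (4 / R ^ 2) * (e * v * (p * x + q * y)) =
              1 / 2 * ((e * p - 4 / R ^ 2 * v * x) ^ 2 + (e * q - 4 / R ^ 2 * v * y) ^ 2) := by
            field_simp
            ring
          have h0 : 0 ≤ 1 / 2 *
            ((e * p - 4 / R ^ 2 * v * x) ^ 2 + (e * q - 4 / R ^ 2 * v * y) ^ 2) := by positivity
          linarith
        have hb : v ^ 2 * (x ^ 2 + y ^ 2) ≤ S ^ 2 * R ^ 2 := by gcongr
        have hc : 8 / R ^ 4 * (v ^ 2 * (x ^ 2 + y ^ 2)) ≤ 8 / R ^ 4 * (S ^ 2 * R ^ 2) :=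
          mul_le_mul_of_nonneg_left hb (by positivity)
        have hd : 8 / R ^ 4 * (S ^ 2 * R ^ 2) = 8 / R ^ 2 * S ^ 2 := by field_simp
        linarith
      have e1 : v * p * (2 * (-(2 / R ^ 2) * e) * x) + v * q * (2 * (-(2 / R ^ 2) * e) * y) =
        -((4 / R ^ 2) * (e * v * (p * x + q * y))) := by ring
      linarith
  rw [hvanish fun z hz => by simp [hz]] at hsum
  rw [integral_add hint'.integrableOn, hsum, zero_add, integral_add, integral_const_mul,
    integral_const_mul, ← hvanish, ← hvanish, setIntegral_const, volume_real_ball hR.le,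
    smul_eq_mul] at hmono
  · have e1 : (1 / δ + 16 / R ^ 2) * S ^ 2 * (Real.pi * R ^ 2) =
        2 * (Real.pi * R ^ 2 * ((1 / (2 * δ) + 8 / R ^ 2) * S ^ 2)) := by
      field_simp
      ring
    rw [e1]
    linarith
  · intro z hz
    simp [hz]
  · intro z hz
    simp [hz]
  · exact (hi2.const_mul δ).integrableOn
  · exact integrableOn_const measure_ball_lt_top.ne
  · exact (hi2.const_mul δ).integrableOn.add (integrableOn_const measure_ball_lt_top.ne)

/-- The inequality of Caccioppoli type, from the function to its second derivatives. -/
lemma setIntegral_hessSq_half_ball_le {K R S : ℝ} (hK : 0 < K) (hR : 0 < R) {z₀ : Plane}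
    {u k : Plane → ℝ} (hu : ContDiff ℝ 2 u) (hc : HasCompactSupport u)
    (hS : ∀ z ∈ Metric.ball z₀ R, |u z| ≤ S)
    (hH : ∀ z ∈ Metric.ball z₀ R, hessSq u z ≤ K * negHessDet u z + k z)
    (hk0 : ∀ z ∈ Metric.ball z₀ R, 0 ≤ k z) (hk : IntegrableOn k (Metric.ball z₀ R)) :
    ∫ z in Metric.ball z₀ (R / 2), hessSq u z ≤
      512 * K ^ 2 * (512 * K ^ 2 + 16) * Real.pi * (S ^ 2 / R ^ 2) +
        8 * ∫ z in Metric.ball z₀ R, k z := by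
  have hpi := Real.pi_pos
  set η : Plane → ℝ := fun z => cutProfile R (‖z - z₀‖ ^ 2) with hη
  have hηc : Continuous η := (continuous_cutProfile R).comp (by fun_prop)
  have hη0 : ∀ z, z ∉ Metric.ball z₀ R → η z = 0 := fun z hz => cutProfile_eq_zero hR hz
  have hηnn : ∀ z, 0 ≤ η z := fun z => cutProfile_nonneg _ _
  have hη1 : ∀ z, η z ≤ 1 := fun z => cutProfile_le_one (by positivity)
  have hφ : ∀ t : ℝ, 0 ≤ t → HasDerivAt (fun t => (cutProfile R t ^ 2) ^ 2)
      (-(4 / R ^ 2) * cutProfile R t ^ 3) t := by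
    intro t _
    refine ((hasDerivAt_cutProfile_sq R t).pow 2).congr_deriv ?_
    push_cast
    ring
  have hψ : Continuous fun t => -(4 / R ^ 2) * cutProfile R t ^ 3 :=
    continuous_const.mul ((continuous_cutProfile R).pow 3)
  have hu' : ContDiff ℝ (1 + 1) u := by norm_num; exact hu
  have cp := fun i => (contDiff_pderiv hu' i).continuous
  have cang := continuous_angularDeriv z₀ (contDiff_pderiv hu' 1)
  have cH := continuous_hessSq hu
  have hkη : IntegrableOn (fun z => (η z ^ 2) ^ 2 * k z) (Metric.ball z₀ R) := by
    refine hk.bdd_mul (c := 1) (by fun_prop) (Eventually.of_forall fun z => ?_)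
    rw [Real.norm_of_nonneg (by positivity)]
    exact pow_le_one₀ (by positivity) (pow_le_one₀ (hηnn z) (hη1 z))
  have h1 := integral_weight_mul_hessSq_le (G := fun z => (η z ^ 2) ^ 2) hu hc (by fun_prop)
    (fun z => by positivity) (fun z hz => by simp [hη0 z hz]) hH hkη
  have h2 : ∫ z in Metric.ball z₀ R, (η z ^ 2) ^ 2 * k z ≤ ∫ z in Metric.ball z₀ R, k z := by
    refine setIntegral_mono_on hkη hk measurableSet_ball fun z hz => ?_
    exact mul_le_of_le_one_left (hk0 z hz) (pow_le_one₀ (by positivity)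
      (pow_le_one₀ (hηnn z) (hη1 z)))
  have h3 := integral_radial_mul_negHessDet hφ hψ z₀ hu hc
  have hi1 : Integrable fun z => η z ^ 2 * (pderiv 0 u z ^ 2 + pderiv 1 u z ^ 2) := by
    refine Continuous.integrable_of_hasCompactSupport (by fun_prop) ?_
    have h1 := hasCompactSupport_pderiv hc
    simp only [sq]
    exact ((h1 0).mul_left.add (h1 1).mul_left).mul_left
  have hi2 : Integrable fun z => (η z ^ 2) ^ 2 * hessSq u z :=
    Continuous.integrable_of_hasCompactSupport (by fun_prop) (hasCompactSupport_hessSq hc).mul_left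
  have h4 : K * ∫ z, (η z ^ 2) ^ 2 * negHessDet u z ≤
      1 / 4 * (∫ z, (η z ^ 2) ^ 2 * hessSq u z) + 64 * K ^ 2 / R ^ 2 *
        ∫ z, η z ^ 2 * (pderiv 0 u z ^ 2 + pderiv 1 u z ^ 2) := by
    rw [h3, ← integral_const_mul, ← integral_const_mul, ← integral_const_mul,
      ← integral_add (hi2.const_mul _) (hi1.const_mul _)]
    refine integral_mono ?_ ((hi2.const_mul _).add (hi1.const_mul _)) fun z => ?_
    · refine (Continuous.integrable_of_hasCompactSupport ?_ ?_).const_mul K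
      · have := continuous_cutProfile R
        fun_prop
      · exact (hasCompactSupport_pderiv hc 0).mul_right.mul_left
    · have hcs := angularDeriv_sq_add_le hu z₀ z
      have hang : angularDeriv z₀ (pderiv 1 u) z ^ 2 ≤ ‖z - z₀‖ ^ 2 * hessSq u z :=
        le_trans (by nlinarith [sq_nonneg (angularDeriv z₀ (pderiv 0 u) z)]) hcs
      have hH0 := hessSq_nonneg u z
      change K * (2 * (-(4 / R ^ 2) * η z ^ 3) *
        (pderiv 0 u z * angularDeriv z₀ (pderiv 1 u) z)) ≤ _
      by_cases hz : z ∈ Metric.ball z₀ R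
      · have hρ : ‖z - z₀‖ ^ 2 ≤ R ^ 2 :=
          pow_le_pow_left₀ (norm_nonneg _) (mem_ball_iff_norm.1 hz).le 2
        have hang' : angularDeriv z₀ (pderiv 1 u) z ^ 2 ≤ R ^ 2 * hessSq u z :=
          hang.trans (mul_le_mul_of_nonneg_right hρ hH0)
        generalize angularDeriv z₀ (pderiv 1 u) z = s at *
        generalize hessSq u z = h at *
        generalize pderiv 0 u z = p
        generalize pderiv 1 u z = q
        generalize η z = e
        have e1 : 1 / 4 * ((e ^ 2) ^ 2 * (s ^ 2 / R ^ 2)) + 64 * K ^ 2 / R ^ 2 * (e ^ 2 * p ^ 2) -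
            K * (2 * (-(4 / R ^ 2) * e ^ 3) * (p * s)) =
            1 / R ^ 2 * (1 / 2 * e ^ 2 * s + 8 * K * e * p) ^ 2 := by
          field_simp
          ring
        have e2 : s ^ 2 / R ^ 2 ≤ h := by
          rw [div_le_iff₀ (by positivity)]
          linarith
        have e3 : 1 / 4 * ((e ^ 2) ^ 2 * (s ^ 2 / R ^ 2)) ≤ 1 / 4 * ((e ^ 2) ^ 2 * h) := by gcongr
        have e4 : 0 ≤ 1 / R ^ 2 * (1 / 2 * e ^ 2 * s + 8 * K * e * p) ^ 2 := by positivity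
        have e5 : 0 ≤ 64 * K ^ 2 / R ^ 2 * (e ^ 2 * q ^ 2) := by positivity
        linarith
      · simp [hη0 z hz]
  -- This `δ` lets another quarter of the energy be absorbed.
  have h5 := integral_cut_sq_mul_gradSq_le (δ := R ^ 2 / (512 * K ^ 2)) (by positivity) hR hu hc hS
  have h6 : 64 * K ^ 2 / R ^ 2 *
      (∫ z, η z ^ 2 * (pderiv 0 u z ^ 2 + pderiv 1 u z ^ 2)) ≤
      1 / 4 * (∫ z, (η z ^ 2) ^ 2 * hessSq u z) +
        64 * K ^ 2 * (512 * K ^ 2 + 16) * Real.pi * (S ^ 2 / R ^ 2) := by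
    refine (mul_le_mul_of_nonneg_left h5 (by positivity)).trans (le_of_eq ?_)
    field_simp
    ring
  have h7 : 1 / 4 * ∫ z in Metric.ball z₀ (R / 2), hessSq u z ≤
      ∫ z, (η z ^ 2) ^ 2 * hessSq u z := by
    rw [← integral_const_mul]
    refine le_trans ?_ (setIntegral_le_integral (s := Metric.ball z₀ (R / 2)) hi2
      (Eventually.of_forall fun z => mul_nonneg (by positivity) (hessSq_nonneg u z)))
    refine setIntegral_mono_on ?_ hi2.integrableOn measurableSet_ball fun z hz => ?_
    · exact ((cH.integrable_of_hasCompactSupport (hasCompactSupport_hessSq hc)).const_mul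
        _).integrableOn
    · refine mul_le_mul_of_nonneg_right ?_ (hessSq_nonneg u z)
      have h34 : 3 / 4 ≤ η z := three_quarters_le_cutProfile hR hz
      have h916 : 9 / 16 ≤ η z ^ 2 := by nlinarith
      nlinarith
  linarith

/-! ### Decay of the energy -/

/-- The regularized singular weight `(t + e) ^ (-α)`, truncated at `t = R²`. -/
noncomputable def singProfile (α R e t : ℝ) : ℝ := (t + e) ^ (-α) * cutProfile R t ^ 2

/-- The derivative of `singProfile α R e` on `[0, ∞)`; the absolute value keeps it continuous on
the whole line. -/
noncomputable def singProfileDeriv (α R e t : ℝ) : ℝ :=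
  -α * (|t| + e) ^ (-α - 1) * cutProfile R t ^ 2 +
    (|t| + e) ^ (-α) * (-(2 / R ^ 2) * cutProfile R t)

lemma hasDerivAt_singProfile (α R : ℝ) {e t : ℝ} (he : 0 < e) (ht : 0 ≤ t) :
    HasDerivAt (singProfile α R e) (singProfileDeriv α R e t) t := by
  have h1 : HasDerivAt (fun t : ℝ => (t + e) ^ (-α)) (-α * (t + e) ^ (-α - 1)) t := by
    have := ((hasDerivAt_id t).add_const e).rpow_const (p := -α) (Or.inl (by simp; positivity))
    refine this.congr_deriv ?_
    simp
  refine (h1.mul (hasDerivAt_cutProfile_sq R t)).congr_deriv ?_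
  rw [singProfileDeriv, abs_of_nonneg ht]

lemma continuous_singProfileDeriv (α R : ℝ) {e : ℝ} (he : 0 < e) :
    Continuous (singProfileDeriv α R e) := by
  have h1 : ∀ p : ℝ, Continuous fun t : ℝ => (|t| + e) ^ p := fun p =>
    Continuous.rpow_const (by fun_prop) fun t => Or.inl (by positivity)
  have h2 := continuous_cutProfile R
  have h3 := h1 (-α)
  have h4 := h1 (-α - 1)
  unfold singProfileDeriv
  fun_prop

lemma singProfile_nonneg {α R e t : ℝ} (he : 0 < e) (ht : 0 ≤ t) : 0 ≤ singProfile α R e t :=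
  mul_nonneg (Real.rpow_nonneg (by positivity) _) (by positivity)

/-- The logarithmic derivative of the singular weight is at most `α / t`, up to a term that comes
from the truncation and has no singularity. -/
lemma abs_singProfileDeriv_mul_le {α R e t : ℝ} (hα0 : 0 < α) (hα1 : α < 1) (hR : 0 < R)
    (he : 0 < e) (ht : 0 ≤ t) :
    |singProfileDeriv α R e t| * t ≤
      α * singProfile α R e t + 2 * R ^ (-(2 * α)) * cutProfile R t := by
  have hte : 0 < t + e := by positivity
  have hc := cutProfile_nonneg R t
  have hneg : |singProfileDeriv α R e t| =
      α * (t + e) ^ (-α - 1) * cutProfile R t ^ 2 +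
        (t + e) ^ (-α) * (2 / R ^ 2 * cutProfile R t) := by
    rw [singProfileDeriv, abs_of_nonneg ht]
    have h1 : 0 ≤ α * (t + e) ^ (-α - 1) * cutProfile R t ^ 2 +
        (t + e) ^ (-α) * (2 / R ^ 2 * cutProfile R t) := by positivity
    rw [← abs_of_nonneg h1, ← abs_neg]
    congr 1
    ring
  rw [hneg, add_mul]
  refine add_le_add ?_ ?_
  · rw [singProfile, Real.rpow_sub_one hte.ne']
    have : α * ((t + e) ^ (-α) / (t + e)) * cutProfile R t ^ 2 * t =
        α * ((t + e) ^ (-α) * cutProfile R t ^ 2) * (t / (t + e)) := by ring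
    rw [this]
    refine mul_le_of_le_one_right (by positivity) ?_
    rw [div_le_one hte]
    linarith
  · rcases hc.eq_or_lt with h0 | hpos
    · simp [← h0]
    · have htR : t ≤ R ^ 2 := by
        by_contra hlt
        refine hpos.ne' (max_eq_right (sub_nonpos.2 ?_))
        rw [one_le_div (by positivity)]
        exact (not_le.1 hlt).le
      have h1 : (t + e) ^ (-α) * t ≤ R ^ 2 * R ^ (-(2 * α)) := by
        have ha : (t + e) ^ (-α) * t ≤ (t + e) ^ (-α) * t ^ α * t ^ (1 - α) := by
          rcases ht.eq_or_lt with h | h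
          · rw [← h, mul_zero]
            positivity
          · rw [mul_assoc, ← Real.rpow_add h]
            simp
        have hb : (t + e) ^ (-α) * t ^ α ≤ 1 := by
          rw [Real.rpow_neg hte.le, ← div_eq_inv_mul, div_le_one (by positivity)]
          exact Real.rpow_le_rpow ht (by linarith) hα0.le
        have hc : t ^ (1 - α) ≤ R ^ 2 * R ^ (-(2 * α)) := by
          have : R ^ 2 * R ^ (-(2 * α)) = (R ^ 2) ^ (1 - α) := by
            rw [← Real.rpow_natCast, ← Real.rpow_add hR, ← Real.rpow_mul hR.le]
            congr 1
            push_cast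
            ring
          rw [this]
          exact Real.rpow_le_rpow ht htR (by linarith)
        calc _ ≤ _ := ha
          _ ≤ 1 * t ^ (1 - α) := mul_le_mul_of_nonneg_right hb (by positivity)
          _ ≤ _ := by rwa [one_mul]
      have h2 : (t + e) ^ (-α) * (2 / R ^ 2 * cutProfile R t) * t =
          2 / R ^ 2 * cutProfile R t * ((t + e) ^ (-α) * t) := by ring
      rw [h2]
      calc _ ≤ 2 / R ^ 2 * cutProfile R t * (R ^ 2 * R ^ (-(2 * α))) :=
            mul_le_mul_of_nonneg_left h1 (by positivity)
        _ = _ := by field_simp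

/-- The energy of the Hessian against the singular weight is controlled by its energy on the ball.
Below the critical exponent, the Jacobian term is absorbed. -/
lemma integral_singProfile_mul_hessSq_le {α K R e : ℝ} (hα0 : 0 < α) (hα1 : α < 1) (hK : 0 < K)
    (hKα : K * α ≤ 3 / 5) (hR : 0 < R) (he : 0 < e) {z₀ : Plane} {u k : Plane → ℝ}
    (hu : ContDiff ℝ 2 u) (hc : HasCompactSupport u)
    (hH : ∀ z ∈ Metric.ball z₀ R, hessSq u z ≤ K * negHessDet u z + k z)
    (hk0 : ∀ z ∈ Metric.ball z₀ R, 0 ≤ k z)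
    (hk : IntegrableOn k (Metric.ball z₀ R))
    (hkα : IntegrableOn (fun z => (‖z - z₀‖ ^ 2) ^ (-α) * k z) (Metric.ball z₀ R)) :
    ∫ z, singProfile α R e (‖z - z₀‖ ^ 2) * hessSq u z ≤
      20 * (Real.pi * K * R ^ (-(2 * α)) * (∫ z in Metric.ball z₀ R, hessSq u z) +
        ∫ z in Metric.ball z₀ R, (‖z - z₀‖ ^ 2) ^ (-α) * k z) := by
  have hpi := Real.pi_pos
  have hpi' := Real.pi_lt_d2
  have hφ : ∀ t : ℝ, 0 ≤ t → HasDerivAt (singProfile α R e) (singProfileDeriv α R e t) t :=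
    fun t ht => hasDerivAt_singProfile α R he ht
  have hψ := continuous_singProfileDeriv α R he
  set G : Plane → ℝ := fun z => singProfile α R e (‖z - z₀‖ ^ 2) with hG
  have hGc : Continuous G := (contDiff_radial hφ hψ z₀).continuous
  have hG0 : ∀ z, 0 ≤ G z := fun z => singProfile_nonneg he (by positivity)
  have hGz : ∀ z, z ∉ Metric.ball z₀ R → G z = 0 := fun z hz => by
    simp [hG, singProfile, cutProfile_eq_zero hR hz]
  have cH := continuous_hessSq hu
  have hiH : Integrable (hessSq u) :=
    cH.integrable_of_hasCompactSupport (hasCompactSupport_hessSq hc)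
  have hGe : ∀ z, G z ≤ e ^ (-α) := by
    intro z
    have h1 : (‖z - z₀‖ ^ 2 + e) ^ (-α) ≤ e ^ (-α) :=
      Real.rpow_le_rpow_of_nonpos he (by nlinarith [sq_nonneg ‖z - z₀‖]) (by linarith)
    have h2 : cutProfile R (‖z - z₀‖ ^ 2) ^ 2 ≤ 1 :=
      pow_le_one₀ (cutProfile_nonneg _ _) (cutProfile_le_one (by positivity))
    calc G z ≤ e ^ (-α) * 1 := mul_le_mul h1 h2 (by positivity) (by positivity)
      _ = _ := mul_one _
  have hGk : IntegrableOn (fun z => G z * k z) (Metric.ball z₀ R) := by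
    refine hk.bdd_mul (c := e ^ (-α)) hGc.aestronglyMeasurable (Eventually.of_forall fun z => ?_)
    rw [Real.norm_of_nonneg (hG0 z)]
    exact hGe z
  have h1 := integral_weight_mul_hessSq_le hu hc hGc hG0 hGz hH hGk
  have h2 := (le_abs_self _).trans (abs_integral_radial_mul_negHessDet_le hφ hψ z₀ hu hc)
  have hiG : Integrable fun z => G z * hessSq u z :=
    (hGc.mul cH).integrable_of_hasCompactSupport (hasCompactSupport_hessSq hc).mul_left
  have hηc : Continuous fun z => cutProfile R (‖z - z₀‖ ^ 2) :=
    (continuous_cutProfile R).comp (by fun_prop)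
  have hiη : Integrable fun z => cutProfile R (‖z - z₀‖ ^ 2) * hessSq u z :=
    (hηc.mul cH).integrable_of_hasCompactSupport (hasCompactSupport_hessSq hc).mul_left
  have h3 : ∫ z, |singProfileDeriv α R e (‖z - z₀‖ ^ 2)| * ‖z - z₀‖ ^ 2 * hessSq u z ≤
      α * (∫ z, G z * hessSq u z) +
        2 * R ^ (-(2 * α)) * ∫ z, cutProfile R (‖z - z₀‖ ^ 2) * hessSq u z := by
    rw [← integral_const_mul, ← integral_const_mul,
      ← integral_add (hiG.const_mul _) (hiη.const_mul _)]
    refine integral_mono ?_ ((hiG.const_mul _).add (hiη.const_mul _)) fun z => ?_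
    · refine Continuous.integrable_of_hasCompactSupport ?_ (hasCompactSupport_hessSq hc).mul_left
      fun_prop
    · have := mul_le_mul_of_nonneg_right (abs_singProfileDeriv_mul_le hα0 hα1 hR he
        (sq_nonneg ‖z - z₀‖)) (hessSq_nonneg u z)
      simp only [hG]
      linarith
  have h4 : ∫ z, cutProfile R (‖z - z₀‖ ^ 2) * hessSq u z ≤
      ∫ z in Metric.ball z₀ R, hessSq u z := by
    rw [← setIntegral_eq_integral_of_forall_compl_eq_zero (s := Metric.ball z₀ R)
      (f := fun z => cutProfile R (‖z - z₀‖ ^ 2) * hessSq u z)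
      fun z hz => by simp [cutProfile_eq_zero hR hz]]
    refine setIntegral_mono_on hiη.integrableOn hiH.integrableOn measurableSet_ball fun z _ => ?_
    exact mul_le_of_le_one_left (hessSq_nonneg u z) (cutProfile_le_one (by positivity))
  have h5 : ∫ z in Metric.ball z₀ R, G z * k z ≤
      ∫ z in Metric.ball z₀ R, (‖z - z₀‖ ^ 2) ^ (-α) * k z := by
    refine integral_mono_ae hGk hkα ?_
    -- The centre is excluded, since the singular weight takes the value `0` there.
    have hne : ∀ᵐ z ∂(volume.restrict (Metric.ball z₀ R)), z ≠ z₀ :=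
      Measure.ae_ne _ z₀
    filter_upwards [hne, ae_restrict_mem measurableSet_ball] with z hz hzb
    refine mul_le_mul_of_nonneg_right ?_ (hk0 z hzb)
    have hpos : 0 < ‖z - z₀‖ ^ 2 := by
      have := norm_pos_iff.2 (sub_ne_zero.2 hz)
      positivity
    have h1 : (‖z - z₀‖ ^ 2 + e) ^ (-α) ≤ (‖z - z₀‖ ^ 2) ^ (-α) :=
      Real.rpow_le_rpow_of_nonpos hpos (by linarith) (by linarith)
    have h2 : cutProfile R (‖z - z₀‖ ^ 2) ^ 2 ≤ 1 :=
      pow_le_one₀ (cutProfile_nonneg _ _) (cutProfile_le_one (by positivity))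
    calc G z ≤ (‖z - z₀‖ ^ 2) ^ (-α) * 1 := mul_le_mul h1 h2 (by positivity) (by positivity)
      _ = _ := mul_one _
  have hI0 : 0 ≤ ∫ z, G z * hessSq u z :=
    integral_nonneg fun z => mul_nonneg (hG0 z) (hessSq_nonneg u z)
  have hRα : 0 < R ^ (-(2 * α)) := by positivity
  have h6 : K * (∫ z, G z * negHessDet u z) ≤ 19 / 20 * (∫ z, G z * hessSq u z) +
      Real.pi * K * R ^ (-(2 * α)) * ∫ z in Metric.ball z₀ R, hessSq u z := by
    have ha : K * (∫ z, G z * negHessDet u z) ≤ K * (Real.pi / 2 * (α * (∫ z, G z * hessSq u z) +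
        2 * R ^ (-(2 * α)) * ∫ z in Metric.ball z₀ R, hessSq u z)) := by
      refine mul_le_mul_of_nonneg_left (h2.trans ?_) hK.le
      refine mul_le_mul_of_nonneg_left (h3.trans ?_) (by positivity)
      have := mul_le_mul_of_nonneg_left h4 (by positivity : 0 ≤ 2 * R ^ (-(2 * α)))
      linarith
    -- The absorbed fraction is below one because `3 / 5 * (π / 2) < 19 / 20`.
    have hb : K * α * (Real.pi / 2) ≤ 19 / 20 := by nlinarith
    have hc := mul_le_mul_of_nonneg_right hb hI0
    linarith
  linarith

lemma rpow_mul_setIntegral_le {α R : ℝ} (hα0 : 0 < α) (hR : 0 < R) {z₀ : Plane} {k : Plane → ℝ}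
    (hk0 : ∀ z ∈ Metric.ball z₀ R, 0 ≤ k z) (hk : IntegrableOn k (Metric.ball z₀ R))
    (hkα : IntegrableOn (fun z => (‖z - z₀‖ ^ 2) ^ (-α) * k z) (Metric.ball z₀ R)) :
    R ^ (-(2 * α)) * ∫ z in Metric.ball z₀ R, k z ≤
      ∫ z in Metric.ball z₀ R, (‖z - z₀‖ ^ 2) ^ (-α) * k z := by
  rw [← integral_const_mul]
  refine integral_mono_ae (hk.const_mul _) hkα ?_
  have hne : ∀ᵐ z ∂(volume.restrict (Metric.ball z₀ R)), z ≠ z₀ := Measure.ae_ne _ z₀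
  filter_upwards [hne, ae_restrict_mem measurableSet_ball] with z hz hzb
  refine mul_le_mul_of_nonneg_right ?_ (hk0 z hzb)
  have hpos := norm_pos_iff.2 (sub_ne_zero.2 hz)
  have hR2 : R ^ (-(2 * α)) = (R ^ 2) ^ (-α) := by
    rw [← Real.rpow_natCast, ← Real.rpow_mul hR.le]
    congr 1
    push_cast
    ring
  rw [hR2]
  exact Real.rpow_le_rpow_of_nonpos (by positivity)
    (pow_le_pow_left₀ hpos.le (mem_ball_iff_norm.1 hzb).le 2) (by linarith)

/-- Growth of the Dirichlet integral of the gradient on small concentric balls. -/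
theorem exists_setIntegral_hessSq_le {α K : ℝ} (hα0 : 0 < α) (hα1 : α < 1) (hK : 0 < K)
    (hKα : K * α ≤ 3 / 5) :
    ∃ C : ℝ, 0 ≤ C ∧ ∀ (z₀ : Plane) (R S : ℝ) (u k : Plane → ℝ), 0 < R → ContDiff ℝ 2 u →
      HasCompactSupport u → (∀ z ∈ Metric.ball z₀ R, |u z| ≤ S) →
      (∀ z ∈ Metric.ball z₀ R, hessSq u z ≤ K * negHessDet u z + k z) →
      (∀ z ∈ Metric.ball z₀ R, 0 ≤ k z) → IntegrableOn k (Metric.ball z₀ R) →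
      IntegrableOn (fun z => (‖z - z₀‖ ^ 2) ^ (-α) * k z) (Metric.ball z₀ R) →
      ∀ r, 0 < r → r ≤ R / 4 → ∫ z in Metric.ball z₀ r, hessSq u z ≤
        C * r ^ (2 * α) * (S ^ 2 * R ^ (-(2 + 2 * α)) +
          ∫ z in Metric.ball z₀ R, (‖z - z₀‖ ^ 2) ^ (-α) * k z) := by
  have hpi := Real.pi_pos
  set A := 512 * K ^ 2 * (512 * K ^ 2 + 16) * Real.pi with hA
  have hA0 : 0 ≤ A := by positivity
  set B := 20 * (4 * Real.pi * K * (A + 8) + 1) with hB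
  have hB0 : 0 ≤ B := by positivity
  refine ⟨4 * B, by positivity, ?_⟩
  intro z₀ R S u k hR hu hc hS hH hk0 hk hkα r hr hrR
  set W := ∫ z in Metric.ball z₀ R, (‖z - z₀‖ ^ 2) ^ (-α) * k z with hW
  have hW0 : 0 ≤ W := setIntegral_nonneg measurableSet_ball fun z hz =>
    mul_nonneg (by positivity) (hk0 z hz)
  have hsub : Metric.ball z₀ (R / 2) ⊆ Metric.ball z₀ R := Metric.ball_subset_ball (by linarith)
  have h1 := setIntegral_hessSq_half_ball_le hK hR hu hc hS hH hk0 hk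
  have h2 := rpow_mul_setIntegral_le hα0 hR hk0 hk hkα
  have h3 := integral_singProfile_mul_hessSq_le (e := r ^ 2) hα0 hα1 hK hKα (half_pos hR)
    (by positivity) hu hc (fun z hz => hH z (hsub hz)) (fun z hz => hk0 z (hsub hz))
    (hk.mono_set hsub) (hkα.mono_set hsub)
  have h4 : ∫ z in Metric.ball z₀ (R / 2), (‖z - z₀‖ ^ 2) ^ (-α) * k z ≤ W := by
    refine setIntegral_mono_set hkα ?_ hsub.eventuallyLE
    filter_upwards [ae_restrict_mem measurableSet_ball] with z hz
    exact mul_nonneg (by positivity) (hk0 z hz)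
  have hRα : 0 < R ^ (-(2 * α)) := by positivity
  have h5 : (R / 2) ^ (-(2 * α)) ≤ 4 * R ^ (-(2 * α)) := by
    rw [Real.div_rpow hR.le (by norm_num), Real.rpow_neg (by norm_num : (0 : ℝ) ≤ 2),
      div_inv_eq_mul, mul_comm]
    refine mul_le_mul_of_nonneg_right ?_ hRα.le
    calc (2 : ℝ) ^ (2 * α) ≤ 2 ^ (2 : ℝ) :=
          Real.rpow_le_rpow_of_exponent_le (by norm_num) (by linarith)
      _ = 4 := by norm_num
  have hRS : R ^ (-(2 * α)) * (S ^ 2 / R ^ 2) = S ^ 2 * R ^ (-(2 + 2 * α)) := by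
    have : R ^ (-(2 + 2 * α)) = R ^ (-(2 * α)) * (R ^ 2)⁻¹ := by
      rw [← Real.rpow_natCast, ← Real.rpow_neg hR.le, ← Real.rpow_add hR]
      congr 1
      push_cast
      ring
    rw [this]
    ring
  have hSR0 : 0 ≤ S ^ 2 * R ^ (-(2 + 2 * α)) := by positivity
  have h6 : (R / 2) ^ (-(2 * α)) * ∫ z in Metric.ball z₀ (R / 2), hessSq u z ≤
      4 * (A * (S ^ 2 * R ^ (-(2 + 2 * α))) + 8 * W) := by
    have h0 : 0 ≤ ∫ z in Metric.ball z₀ (R / 2), hessSq u z :=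
      integral_nonneg fun z => hessSq_nonneg u z
    calc _ ≤ 4 * R ^ (-(2 * α)) * ∫ z in Metric.ball z₀ (R / 2), hessSq u z :=
          mul_le_mul_of_nonneg_right h5 h0
      _ ≤ 4 * R ^ (-(2 * α)) * (A * (S ^ 2 / R ^ 2) + 8 * ∫ z in Metric.ball z₀ R, k z) :=
          mul_le_mul_of_nonneg_left h1 (by positivity)
      _ = 4 * (A * (R ^ (-(2 * α)) * (S ^ 2 / R ^ 2)) +
          8 * (R ^ (-(2 * α)) * ∫ z in Metric.ball z₀ R, k z)) := by ring
      _ ≤ _ := by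
        rw [hRS]
        linarith
  have h7 : ∫ z, singProfile α (R / 2) (r ^ 2) (‖z - z₀‖ ^ 2) * hessSq u z ≤
      B * (S ^ 2 * R ^ (-(2 + 2 * α)) + W) := by
    refine h3.trans ?_
    have ha : Real.pi * K * (R / 2) ^ (-(2 * α)) * ∫ z in Metric.ball z₀ (R / 2), hessSq u z ≤
        Real.pi * K * (4 * (A * (S ^ 2 * R ^ (-(2 + 2 * α))) + 8 * W)) := by
      rw [mul_assoc]
      exact mul_le_mul_of_nonneg_left h6 (by positivity)
    have hb : 0 ≤ Real.pi * K * (8 * (S ^ 2 * R ^ (-(2 + 2 * α))) + A * W) := by positivity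
    rw [hB]
    nlinarith
  -- On the ball of radius `r` the weight is bounded below by a multiple of `r ^ (-2 α)`.
  have h8 : 1 / 4 * r ^ (-(2 * α)) * ∫ z in Metric.ball z₀ r, hessSq u z ≤
      ∫ z, singProfile α (R / 2) (r ^ 2) (‖z - z₀‖ ^ 2) * hessSq u z := by
    have hGc : Continuous fun z => singProfile α (R / 2) (r ^ 2) (‖z - z₀‖ ^ 2) :=
      (contDiff_radial (fun t ht => hasDerivAt_singProfile α (R / 2) (by positivity) ht)
        (continuous_singProfileDeriv α (R / 2) (by positivity)) z₀).continuous
    have hi : Integrable fun z => singProfile α (R / 2) (r ^ 2) (‖z - z₀‖ ^ 2) * hessSq u z :=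
      (hGc.mul (continuous_hessSq hu)).integrable_of_hasCompactSupport
        (hasCompactSupport_hessSq hc).mul_left
    have hiH : Integrable (hessSq u) :=
      (continuous_hessSq hu).integrable_of_hasCompactSupport (hasCompactSupport_hessSq hc)
    rw [← integral_const_mul]
    refine le_trans ?_ (setIntegral_le_integral (s := Metric.ball z₀ r) hi
      (Eventually.of_forall fun z => mul_nonneg (singProfile_nonneg (by positivity)
        (by positivity)) (hessSq_nonneg u z)))
    refine setIntegral_mono_on (hiH.const_mul _).integrableOn hi.integrableOn measurableSet_ball
      fun z hz => ?_
    refine mul_le_mul_of_nonneg_right ?_ (hessSq_nonneg u z)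
    have hcut : 3 / 4 ≤ cutProfile (R / 2) (‖z - z₀‖ ^ 2) :=
      three_quarters_le_cutProfile (half_pos hR) (Metric.ball_subset_ball (by linarith) hz)
    have hcut2 : 1 / 2 ≤ cutProfile (R / 2) (‖z - z₀‖ ^ 2) ^ 2 := by nlinarith
    have hz' : ‖z - z₀‖ ^ 2 ≤ r ^ 2 :=
      pow_le_pow_left₀ (norm_nonneg _) (mem_ball_iff_norm.1 hz).le 2
    have hpow : 1 / 2 * r ^ (-(2 * α)) ≤ (‖z - z₀‖ ^ 2 + r ^ 2) ^ (-α) := by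
      have ha : (2 * r ^ 2) ^ (-α) ≤ (‖z - z₀‖ ^ 2 + r ^ 2) ^ (-α) :=
        Real.rpow_le_rpow_of_nonpos (by positivity) (by linarith) (by linarith)
      refine le_trans ?_ ha
      rw [Real.mul_rpow (by norm_num) (by positivity)]
      have hb : (r ^ 2) ^ (-α) = r ^ (-(2 * α)) := by
        rw [← Real.rpow_natCast, ← Real.rpow_mul hr.le]
        congr 1
        push_cast
        ring
      rw [hb]
      refine mul_le_mul_of_nonneg_right ?_ (by positivity)
      calc (1 / 2 : ℝ) = 2 ^ (-1 : ℝ) := by rw [Real.rpow_neg_one]; norm_num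
        _ ≤ 2 ^ (-α) := Real.rpow_le_rpow_of_exponent_le (by norm_num) (by linarith)
    calc 1 / 4 * r ^ (-(2 * α)) = 1 / 2 * r ^ (-(2 * α)) * (1 / 2) := by ring
      _ ≤ _ := mul_le_mul hpow hcut2 (by norm_num) (by positivity)
  have hrα : 0 < r ^ (2 * α) := by positivity
  have h9 := h8.trans h7
  rw [Real.rpow_neg hr.le] at h9
  have h10 := mul_le_mul_of_nonneg_left h9 (by positivity : 0 ≤ 4 * r ^ (2 * α))
  calc _ = 4 * r ^ (2 * α) * (1 / 4 * (r ^ (2 * α))⁻¹ *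
        ∫ z in Metric.ball z₀ r, hessSq u z) := by field_simp
    _ ≤ _ := h10
    _ = _ := by ring

/-! ### Dirichlet growth -/

section DirichletGrowth

open scoped Pointwise

variable {F : Type*} [NormedAddCommGroup F] [NormedSpace ℝ F]

lemma setIntegral_norm_fderiv_le {w : Plane → F} (hw : ContDiff ℝ 1 w) {α m r : ℝ} (hm : 0 ≤ m)
    (hr : 0 < r) {z₀ : Plane}
    (hD : ∫ z in Metric.ball z₀ r, ‖fderiv ℝ w z‖ ^ 2 ≤ m ^ 2 * r ^ (2 * α)) :
    ∫ z in Metric.ball z₀ r, ‖fderiv ℝ w z‖ ≤ 2 * m * r ^ (1 + α) := by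
  have hc : Continuous fun z => ‖fderiv ℝ w z‖ := (hw.continuous_fderiv one_ne_zero).norm
  have hi : ∀ {f : Plane → ℝ}, Continuous f → IntegrableOn f (Metric.ball z₀ r) := fun hf =>
    (hf.continuousOn.integrableOn_compact (isCompact_closedBall z₀ r)).mono_set
      Metric.ball_subset_closedBall
  have : IsFiniteMeasure (volume.restrict (Metric.ball z₀ r)) :=
    ⟨by rw [Measure.restrict_apply_univ]; exact measure_ball_lt_top⟩
  have h := sq_integral_le_measureReal_mul_integral_sq (hi hc) (hi (hc.pow 2))
  rw [measureReal_restrict_apply_univ, volume_real_ball hr.le] at h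
  refine abs_le_of_sq_le_sq' ?_ (by positivity) |>.2
  calc _ ≤ Real.pi * r ^ 2 * (m ^ 2 * r ^ (2 * α)) :=
        h.trans (mul_le_mul_of_nonneg_left hD (by have := Real.pi_pos; positivity))
    _ ≤ 4 * r ^ 2 * (m ^ 2 * r ^ (2 * α)) := by
        have := Real.pi_le_four
        gcongr
    _ = _ := by
        rw [Real.rpow_add hr, Real.rpow_one, mul_comm 2 α, Real.rpow_mul hr.le, Real.rpow_two]
        ring

/-- Along the rays from the centre, the deviation from the value at the centre is bounded by the
integrals of the derivative over all smaller concentric balls, which are summable because of the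
growth condition. -/
lemma setIntegral_norm_sub_center_le [CompleteSpace F] {w : Plane → F} (hw : ContDiff ℝ 1 w)
    {α m ρ : ℝ} (hα : 0 < α) (hm : 0 ≤ m) (hρ : 0 < ρ) {z₀ : Plane}
    (hD : ∀ r, 0 < r → r ≤ ρ →
      ∫ z in Metric.ball z₀ r, ‖fderiv ℝ w z‖ ^ 2 ≤ m ^ 2 * r ^ (2 * α)) :
    ∫ z in Metric.ball z₀ ρ, ‖w z - w z₀‖ ≤ 2 / α * m * ρ ^ (2 + α) := by
  have cD : Continuous fun z => ‖fderiv ℝ w z‖ := (hw.continuous_fderiv one_ne_zero).norm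
  have cw := hw.continuous
  have hi : ∀ {f : Plane → ℝ}, Continuous f → ∀ z r, IntegrableOn f (Metric.ball z r) :=
    fun hf z r => (hf.continuousOn.integrableOn_compact (isCompact_closedBall z r)).mono_set
      Metric.ball_subset_closedBall
  have htrans : ∀ (f : Plane → ℝ) (r : ℝ),
      ∫ v in Metric.ball 0 r, f (z₀ + v) = ∫ z in Metric.ball z₀ r, f z := by
    intro f r
    have h := (measurePreserving_add_left volume z₀).setIntegral_preimage_emb
      (measurableEmbedding_addLeft z₀) f (Metric.ball z₀ r)
    rwa [preimage_add_ball, sub_self] at h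
  have hpt : ∀ v ∈ Metric.ball (0 : Plane) ρ,
      ‖w (z₀ + v) - w z₀‖ ≤ ρ * ∫ t in (0 : ℝ)..1, ‖fderiv ℝ w (z₀ + t • v)‖ := by
    intro v hv
    have hd : ∀ t ∈ uIcc (0 : ℝ) 1,
        HasDerivAt (fun t : ℝ => w (z₀ + t • v)) (fderiv ℝ w (z₀ + t • v) v) t := by
      intro t _
      have h1 : HasDerivAt (fun t : ℝ => z₀ + t • v) v t := by
        simpa using ((hasDerivAt_id t).smul_const v).const_add z₀
      exact (hw.differentiable one_ne_zero _).hasFDerivAt.comp_hasDerivAt t h1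
    have hcd : Continuous fun t : ℝ => fderiv ℝ w (z₀ + t • v) :=
      (hw.continuous_fderiv one_ne_zero).comp (by fun_prop)
    have hftc := intervalIntegral.integral_eq_sub_of_hasDerivAt hd
      (Continuous.intervalIntegrable (by fun_prop) _ _)
    simp only [one_smul, zero_smul, add_zero] at hftc
    rw [← hftc, ← intervalIntegral.integral_const_mul]
    refine intervalIntegral.norm_integral_le_of_norm_le zero_le_one ?_
      (Continuous.intervalIntegrable (by fun_prop) _ _)
    refine Eventually.of_forall fun t _ => ?_
    rw [mul_comm]
    refine (ContinuousLinearMap.le_opNorm _ _).trans ?_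
    exact mul_le_mul_of_nonneg_left (mem_ball_zero_iff.1 hv).le (norm_nonneg _)
  have hprod : Integrable (Function.uncurry fun (t : ℝ) (v : Plane) => ‖fderiv ℝ w (z₀ + t • v)‖)
      ((volume.restrict (uIoc (0 : ℝ) 1)).prod (volume.restrict (Metric.ball (0 : Plane) ρ))) := by
    rw [Measure.prod_restrict]
    have hcont : Continuous (Function.uncurry fun (t : ℝ) (v : Plane) =>
        ‖fderiv ℝ w (z₀ + t • v)‖) :=
      cD.comp (by fun_prop : Continuous fun x : ℝ × Plane => z₀ + x.1 • x.2)
    refine (hcont.continuousOn.integrableOn_compact (μ := volume.prod volume)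
      ((isCompact_Icc (a := (0 : ℝ)) (b := 1)).prod
        (isCompact_closedBall (0 : Plane) ρ))).mono_set ?_
    rw [uIoc_of_le zero_le_one]
    exact prod_mono Ioc_subset_Icc_self Metric.ball_subset_closedBall
  have hslice : ∀ t ∈ Ioc (0 : ℝ) 1, ∫ v in Metric.ball (0 : Plane) ρ, ‖fderiv ℝ w (z₀ + t • v)‖ ≤
      2 * m * ρ ^ (1 + α) * t ^ (α - 1) := by
    intro t ht
    have h1 := Measure.setIntegral_comp_smul_of_pos volume (fun v => ‖fderiv ℝ w (z₀ + v)‖)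
      (Metric.ball (0 : Plane) ρ) ht.1
    have hball : t • Metric.ball (0 : Plane) ρ = Metric.ball 0 (t * ρ) := by
      rw [smul_ball ht.1.ne', smul_zero, Real.norm_of_nonneg ht.1.le]
    rw [hball, htrans (fun z => ‖fderiv ℝ w z‖), finrank_euclideanSpace_fin, smul_eq_mul] at h1
    rw [h1]
    have htρ : 0 < t * ρ := mul_pos ht.1 hρ
    have h2 := setIntegral_norm_fderiv_le hw hm htρ
      (hD _ htρ (mul_le_of_le_one_left hρ.le ht.2))
    calc _ ≤ (t ^ 2)⁻¹ * (2 * m * (t * ρ) ^ (1 + α)) :=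
          mul_le_mul_of_nonneg_left h2 (by have := ht.1; positivity)
      _ = _ := by
        have h3 : t ^ (α - 1) = t ^ (1 + α) * (t ^ 2)⁻¹ := by
          rw [← Real.rpow_natCast t 2, ← Real.rpow_neg ht.1.le, ← Real.rpow_add ht.1]
          congr 1
          push_cast
          ring
        rw [Real.mul_rpow ht.1.le hρ.le, h3]
        ring
  have hrpow : IntervalIntegrable (fun t : ℝ => t ^ (α - 1)) volume 0 1 :=
    intervalIntegral.intervalIntegrable_rpow' (by linarith)
  calc ∫ z in Metric.ball z₀ ρ, ‖w z - w z₀‖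
      = ∫ v in Metric.ball 0 ρ, ‖w (z₀ + v) - w z₀‖ := (htrans (fun z => ‖w z - w z₀‖) ρ).symm
    _ ≤ ∫ v in Metric.ball 0 ρ, ρ * ∫ t in (0 : ℝ)..1, ‖fderiv ℝ w (z₀ + t • v)‖ := by
        refine setIntegral_mono_on (hi (by fun_prop) _ _) ?_ measurableSet_ball hpt
        have := hprod.integral_prod_right
        simp only [Function.uncurry] at this
        simp only [intervalIntegral.integral_of_le zero_le_one]
        rw [uIoc_of_le zero_le_one] at this
        exact this.const_mul ρ
    _ = ρ * ∫ t in (0 : ℝ)..1, ∫ v in Metric.ball (0 : Plane) ρ, ‖fderiv ℝ w (z₀ + t • v)‖ := by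
        rw [integral_const_mul, intervalIntegral_integral_swap hprod]
    _ ≤ ρ * ∫ t in (0 : ℝ)..1, 2 * m * ρ ^ (1 + α) * t ^ (α - 1) := by
        refine mul_le_mul_of_nonneg_left ?_ hρ.le
        refine intervalIntegral.integral_mono_on_of_le_Ioo zero_le_one ?_ (hrpow.const_mul _)
          fun t ht => hslice t (Ioo_subset_Ioc_self ht)
        rw [intervalIntegrable_iff]
        exact hprod.integral_prod_left
    _ = 2 / α * m * ρ ^ (2 + α) := by
        rw [intervalIntegral.integral_const_mul, integral_rpow (Or.inl (by linarith))]
        have h3 : ρ ^ (2 + α) = ρ * ρ ^ (1 + α) := by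
          rw [show 2 + α = 1 + (1 + α) by ring, Real.rpow_add hρ, Real.rpow_one]
        rw [h3, sub_add_cancel, Real.one_rpow, Real.zero_rpow hα.ne']
        field_simp
        ring

/-- Morrey's criterion: growth of the Dirichlet integral implies Hölder continuity. -/
theorem norm_sub_le_of_dirichlet_growth [CompleteSpace F] {w : Plane → F} (hw : ContDiff ℝ 1 w)
    {α m : ℝ} (hα : 0 < α) (hm : 0 ≤ m) {z₀ z₁ : Plane}
    (hD₀ : ∀ r, 0 < r → r ≤ ‖z₀ - z₁‖ →
      ∫ z in Metric.ball z₀ r, ‖fderiv ℝ w z‖ ^ 2 ≤ m ^ 2 * r ^ (2 * α))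
    (hD₁ : ∀ r, 0 < r → r ≤ ‖z₀ - z₁‖ →
      ∫ z in Metric.ball z₁ r, ‖fderiv ℝ w z‖ ^ 2 ≤ m ^ 2 * r ^ (2 * α)) :
    ‖w z₀ - w z₁‖ ≤ 8 / α * m * ‖z₀ - z₁‖ ^ α := by
  rcases eq_or_ne z₀ z₁ with rfl | hne
  · simp only [sub_self, norm_zero]
    positivity
  set ρ := ‖z₀ - z₁‖ with hρ
  have hρ0 : 0 < ρ := norm_pos_iff.2 (sub_ne_zero.2 hne)
  have h0 := setIntegral_norm_sub_center_le hw hα hm hρ0 hD₀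
  have h1 := setIntegral_norm_sub_center_le hw hα hm hρ0 hD₁
  set B := Metric.ball (midpoint ℝ z₀ z₁) (ρ / 2) with hB
  have hd : dist z₀ z₁ = ρ := dist_eq_norm _ _
  have hB0 : B ⊆ Metric.ball z₀ ρ := Metric.ball_subset_ball' (by
    rw [dist_midpoint_left, hd, Real.norm_of_nonneg (by norm_num)]
    linarith)
  have hB1 : B ⊆ Metric.ball z₁ ρ := Metric.ball_subset_ball' (by
    rw [dist_midpoint_right, hd, Real.norm_of_nonneg (by norm_num)]
    linarith)
  have cw := hw.continuous
  have hi : ∀ {f : Plane → ℝ}, Continuous f → ∀ z r, IntegrableOn f (Metric.ball z r) :=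
    fun hf z r => (hf.continuousOn.integrableOn_compact (isCompact_closedBall z r)).mono_set
      Metric.ball_subset_closedBall
  have i0 := hi (f := fun z => ‖w z - w z₀‖) (by fun_prop)
  have i1 := hi (f := fun z => ‖w z - w z₁‖) (by fun_prop)
  have h2 : Real.pi * (ρ / 2) ^ 2 * ‖w z₀ - w z₁‖ ≤
      ∫ z in B, (‖w z - w z₀‖ + ‖w z - w z₁‖) := by
    have e : ∫ _ in B, ‖w z₀ - w z₁‖ = Real.pi * (ρ / 2) ^ 2 * ‖w z₀ - w z₁‖ := by
      rw [setIntegral_const, volume_real_ball (by positivity), smul_eq_mul]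
    rw [← e]
    refine setIntegral_mono_on (integrableOn_const measure_ball_lt_top.ne)
      ((i0 _ _).add (i1 _ _)) measurableSet_ball fun z _ => ?_
    rw [norm_sub_rev (w z) (w z₀)]
    exact norm_sub_le_norm_sub_add_norm_sub _ _ _
  have h3 : ∫ z in B, ‖w z - w z₀‖ ≤ ∫ z in Metric.ball z₀ ρ, ‖w z - w z₀‖ :=
    setIntegral_mono_set (i0 _ _) (Eventually.of_forall fun z => norm_nonneg _) hB0.eventuallyLE
  have h4 : ∫ z in B, ‖w z - w z₁‖ ≤ ∫ z in Metric.ball z₁ ρ, ‖w z - w z₁‖ :=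
    setIntegral_mono_set (i1 _ _) (Eventually.of_forall fun z => norm_nonneg _) hB1.eventuallyLE
  rw [integral_add (i0 _ _) (i1 _ _)] at h2
  have h5 : Real.pi * (ρ / 2) ^ 2 * ‖w z₀ - w z₁‖ ≤ 4 / α * m * ρ ^ (2 + α) := by
    have : 4 / α * m * ρ ^ (2 + α) = 2 / α * m * ρ ^ (2 + α) + 2 / α * m * ρ ^ (2 + α) := by ring
    linarith
  have h6 : 1 / 2 * ρ ^ 2 * ‖w z₀ - w z₁‖ ≤ Real.pi * (ρ / 2) ^ 2 * ‖w z₀ - w z₁‖ := by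
    refine mul_le_mul_of_nonneg_right ?_ (norm_nonneg _)
    nlinarith [Real.pi_gt_three, sq_nonneg ρ]
  have h7 : 4 / α * m * ρ ^ (2 + α) = 1 / 2 * ρ ^ 2 * (8 / α * m * ρ ^ α) := by
    rw [Real.rpow_add hρ0, Real.rpow_two]
    ring
  refine le_of_mul_le_mul_left (h6.trans (h5.trans h7.le)) (by positivity)

end DirichletGrowth

/-! ### Integrability of the right-hand side against the singular weight -/

lemma integrableOn_norm_sq_rpow_neg {s : ℝ} (hs : s < 1) (r : ℝ) :
    IntegrableOn (fun v : Plane => (‖v‖ ^ 2) ^ (-s)) (Metric.ball 0 r) := by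
  rw [integrableOn_fun_norm_addHaar volume (f := fun y : ℝ => (y ^ 2) ^ (-s)),
    finrank_euclideanSpace_fin]
  rcases le_or_gt r 0 with hr | hr
  · simp [Ioo_eq_empty (not_lt.2 hr)]
  have h := (intervalIntegral.intervalIntegrable_rpow' (a := 0) (b := r)
    (by linarith : -1 < 1 - 2 * s)).1.mono_set Ioo_subset_Ioc_self
  refine h.congr_fun (fun y hy => ?_) measurableSet_Ioo
  have hy0 : 0 < y := hy.1
  simp only [smul_eq_mul]
  rw [← Real.rpow_natCast y 2, ← Real.rpow_mul hy0.le, Nat.add_one_sub_one, pow_one,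
    sub_eq_add_neg, Real.rpow_add hy0, Real.rpow_one]
  congr 2
  push_cast
  ring

/-- Hölder's inequality for `g²` against the weight `|z - z₀| ^ (-2 α)`. The condition on `β` says
that the weight lies in the dual space, uniformly in `z₀`. -/
lemma exists_setIntegral_rpow_mul_sq_le {α β : ℝ} (hα0 : 0 < α) (hα1 : α < 1)
    (hβ : 1 / (1 - α) < β) (R₀ : ℝ) :
    ∃ A : ℝ, 0 ≤ A ∧ ∀ (z₀ : Plane) (R : ℝ) (g : Plane → ℝ), R ≤ R₀ →
      MemLp g (ENNReal.ofReal (2 * β)) (volume.restrict (Metric.ball z₀ R)) →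
      IntegrableOn (fun z => g z ^ 2) (Metric.ball z₀ R) ∧
      IntegrableOn (fun z => (‖z - z₀‖ ^ 2) ^ (-α) * g z ^ 2) (Metric.ball z₀ R) ∧
      ∫ z in Metric.ball z₀ R, (‖z - z₀‖ ^ 2) ^ (-α) * g z ^ 2 ≤
        A * (eLpNorm g (ENNReal.ofReal (2 * β)) (volume.restrict (Metric.ball z₀ R))).toReal ^ 2 := by
  have h1α : 0 < 1 - α := by linarith
  have hβα : 1 < β * (1 - α) := by rwa [div_lt_iff₀ h1α] at hβ
  have hβ1 : 1 < β := by nlinarith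
  have hconj : (Real.conjExponent β).HolderConjugate β :=
    (Real.HolderConjugate.conjExponent hβ1).symm
  set q := Real.conjExponent β with hq
  have hq0 : 0 < q := hconj.pos
  have hqα : α * q < 1 := by
    rw [hq, Real.conjExponent, mul_div_assoc', div_lt_one (by linarith)]
    linarith
  set A₀ := ∫ v in Metric.ball (0 : Plane) R₀, (‖v‖ ^ 2) ^ (-(α * q)) with hA₀
  have hA0 : 0 ≤ A₀ := integral_nonneg fun v => by positivity
  refine ⟨A₀ ^ (1 / q), by positivity, ?_⟩
  intro z₀ R g hR hg
  have hfin : IsFiniteMeasure (volume.restrict (Metric.ball z₀ R)) :=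
    ⟨by rw [Measure.restrict_apply_univ]; exact measure_ball_lt_top⟩
  have hVq : ∀ z : Plane, ‖(‖z - z₀‖ ^ 2) ^ (-α)‖ ^ q = (‖z - z₀‖ ^ 2) ^ (-(α * q)) := by
    intro z
    rw [Real.norm_of_nonneg (by positivity), ← Real.rpow_mul (by positivity), neg_mul]
  have hVm : Measurable fun z : Plane => (‖z - z₀‖ ^ 2) ^ (-α) := by fun_prop
  have htrans : ∀ r, IntegrableOn (fun z : Plane => (‖z - z₀‖ ^ 2) ^ (-(α * q))) (Metric.ball z₀ r) ∧
      ∫ z in Metric.ball z₀ r, (‖z - z₀‖ ^ 2) ^ (-(α * q)) =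
        ∫ v in Metric.ball (0 : Plane) r, (‖v‖ ^ 2) ^ (-(α * q)) := by
    intro r
    have hpre : (fun z => z - z₀) ⁻¹' Metric.ball (0 : Plane) r = Metric.ball z₀ r := by
      ext z
      simp [dist_eq_norm]
    have hmp := measurePreserving_sub_right (volume : Measure Plane) z₀
    have hme : MeasurableEmbedding fun z : Plane => z - z₀ := measurableEmbedding_subRight z₀
    constructor
    · have h := (hmp.integrableOn_comp_preimage hme
        (f := fun v : Plane => (‖v‖ ^ 2) ^ (-(α * q)))).2 (integrableOn_norm_sq_rpow_neg hqα r)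
      rwa [hpre] at h
    · have h := hmp.setIntegral_preimage_emb hme
        (fun v : Plane => (‖v‖ ^ 2) ^ (-(α * q))) (Metric.ball 0 r)
      rwa [hpre] at h
  have hV : MemLp (fun z => (‖z - z₀‖ ^ 2) ^ (-α)) (ENNReal.ofReal q)
      (volume.restrict (Metric.ball z₀ R)) := by
    rw [← integrable_norm_rpow_iff hVm.aestronglyMeasurable (by simpa using hq0)
      ENNReal.ofReal_ne_top, ENNReal.toReal_ofReal hq0.le]
    simp only [hVq]
    exact (htrans R).1
  have hgm := hg.1
  have hgβ : Integrable (fun z => ‖g z‖ ^ (2 * β)) (volume.restrict (Metric.ball z₀ R)) := by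
    have := hg.integrable_norm_rpow (by simp; linarith) ENNReal.ofReal_ne_top
    rwa [ENNReal.toReal_ofReal (by linarith)] at this
  have hg2 : ∀ z, ‖g z ^ 2‖ ^ β = ‖g z‖ ^ (2 * β) := by
    intro z
    rw [norm_pow, ← Real.rpow_natCast, ← Real.rpow_mul (norm_nonneg _)]
    norm_num
  have hG : MemLp (fun z => g z ^ 2) (ENNReal.ofReal β) (volume.restrict (Metric.ball z₀ R)) := by
    have hg2m : AEStronglyMeasurable (fun z => g z ^ 2) (volume.restrict (Metric.ball z₀ R)) :=
      hgm.pow 2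
    rw [← integrable_norm_rpow_iff hg2m (by simp; linarith)
      ENNReal.ofReal_ne_top, ENNReal.toReal_ofReal (by linarith)]
    simp only [hg2]
    exact hgβ
  refine ⟨hG.integrable (by rw [ENNReal.one_le_ofReal]; exact hβ1.le), ?_, ?_⟩
  · have := hconj.ennrealOfReal
    exact hV.integrable_mul hG
  · refine (integral_mul_le_Lp_mul_Lq_of_nonneg hconj (Eventually.of_forall fun z => by positivity)
      (Eventually.of_forall fun z => by positivity) hV hG).trans ?_
    have e1 : ∫ z in Metric.ball z₀ R, ((‖z - z₀‖ ^ 2) ^ (-α)) ^ q ≤ A₀ := by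
      have h1 : ∀ z : Plane, ((‖z - z₀‖ ^ 2) ^ (-α)) ^ q = (‖z - z₀‖ ^ 2) ^ (-(α * q)) := fun z => by
        rw [← Real.rpow_mul (by positivity), neg_mul]
      simp only [h1]
      rw [hA₀, ← (htrans R₀).2]
      exact setIntegral_mono_set (htrans R₀).1 (Eventually.of_forall fun z => by positivity)
        (Metric.ball_subset_ball hR).eventuallyLE
    have e2 : (∫ z in Metric.ball z₀ R, (g z ^ 2) ^ β) ^ (1 / β) =
        (eLpNorm g (ENNReal.ofReal (2 * β)) (volume.restrict (Metric.ball z₀ R))).toReal ^ 2 := by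
      rw [hg.eLpNorm_eq_integral_rpow_norm (by simp; linarith) ENNReal.ofReal_ne_top,
        ENNReal.toReal_ofReal (by positivity), ENNReal.toReal_ofReal (by linarith)]
      have h2 : ∀ z, (g z ^ 2) ^ β = ‖g z‖ ^ (2 * β) := fun z => by
        rw [← hg2, Real.norm_of_nonneg (by positivity)]
      simp only [h2]
      rw [← Real.rpow_natCast, ← Real.rpow_mul (integral_nonneg fun z => by positivity)]
      congr 1
      field_simp
      norm_num
    rw [e2]
    refine mul_le_mul_of_nonneg_right ?_ (by positivity)
    exact Real.rpow_le_rpow (integral_nonneg fun z => by positivity) e1 (by positivity)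

/-! ### Localization -/

lemma pderiv_congr_of_eventuallyEq {f g : Plane → ℝ} {z : Plane} (h : f =ᶠ[𝓝 z] g) (i : Fin 2) :
    pderiv i f =ᶠ[𝓝 z] pderiv i g := by
  filter_upwards [h.fderiv (𝕜 := ℝ)] with x hx
  rw [pderiv, pderiv, hx]

lemma hessSq_negHessDet_congr {f g : Plane → ℝ} {z : Plane} (h : f =ᶠ[𝓝 z] g) :
    hessSq f z = hessSq g z ∧ negHessDet f z = negHessDet g z := by
  have h2 := fun i j => (pderiv_congr_of_eventuallyEq (pderiv_congr_of_eventuallyEq h j) i).self_of_nhds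
  simp only [hessSq, negHessDet, h2, and_self]

lemma norm_fderiv_fderiv_sq_le {u : Plane → ℝ} (hu : ContDiff ℝ 2 u) (z : Plane) :
    ‖fderiv ℝ (fderiv ℝ u) z‖ ^ 2 ≤ hessSq u z := by
  have hd : DifferentiableAt ℝ (fderiv ℝ u) z :=
    (hu.fderiv_right (m := 1) (by norm_num)).differentiable one_ne_zero z
  have key : ∀ i j : Fin 2, fderiv ℝ (fderiv ℝ u) z (EuclideanSpace.single i 1)
      (EuclideanSpace.single j 1) = pderiv i (pderiv j u) z := by
    intro i j
    unfold pderiv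
    rw [fderiv_clm_apply hd (differentiableAt_const _)]
    simp
  have hdec : ∀ v : Plane, v = v 0 • EuclideanSpace.single 0 1 + v 1 • EuclideanSpace.single 1 1 := by
    intro v
    ext i
    fin_cases i <;> simp
  have hnorm : ∀ v : Plane, ‖v‖ ^ 2 = v 0 ^ 2 + v 1 ^ 2 := fun v => by
    simpa using norm_sub_sq v 0
  have hH := hessSq_nonneg u z
  have hbound : ‖fderiv ℝ (fderiv ℝ u) z‖ ≤ √(hessSq u z) := by
    refine ContinuousLinearMap.opNorm_le_bound _ (Real.sqrt_nonneg _) fun v => ?_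
    refine ContinuousLinearMap.opNorm_le_bound _ (by positivity) fun e => ?_
    refine abs_le_of_sq_le_sq ?_ (by positivity)
    rw [mul_pow, mul_pow, Real.sq_sqrt hH, hnorm, hnorm, hdec v, hdec e]
    simp only [map_add, map_smul, _root_.add_apply, _root_.smul_apply,
      smul_eq_mul, key]
    rw [pderiv_comm hu 0 1, hessSq]
    simp only [PiLp.add_apply, PiLp.smul_apply, PiLp.single_apply, smul_eq_mul]
    norm_num
    generalize pderiv 0 (pderiv 0 u) z = X
    generalize pderiv 1 (pderiv 0 u) z = Y
    generalize pderiv 1 (pderiv 1 u) z = Z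
    generalize v 0 = a
    generalize v 1 = b
    generalize e 0 = c
    generalize e 1 = d
    have h1 : (X * a + Y * b) ^ 2 + (Y * a + Z * b) ^ 2 ≤
        (X ^ 2 + 2 * Y ^ 2 + Z ^ 2) * (a ^ 2 + b ^ 2) := by
      nlinarith [sq_nonneg (X * b - Y * a), sq_nonneg (Y * b - Z * a)]
    have h2 : ((X * a + Y * b) * c + (Y * a + Z * b) * d) ^ 2 ≤
        ((X * a + Y * b) ^ 2 + (Y * a + Z * b) ^ 2) * (c ^ 2 + d ^ 2) := by
      nlinarith [sq_nonneg ((X * a + Y * b) * d - (Y * a + Z * b) * c)]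
    have h3 := mul_le_mul_of_nonneg_right h1 (by positivity : 0 ≤ c ^ 2 + d ^ 2)
    nlinarith
  exact (pow_le_pow_left₀ (norm_nonneg (fderiv ℝ (fderiv ℝ u) z)) hbound 2).trans_eq (Real.sq_sqrt hH)

lemma exists_contDiff_hasCompactSupport_eqOn {u : Plane → ℝ} {z : Plane} {d : ℝ} (hd : 0 < d)
    (hu : ContDiffOn ℝ 2 u (Metric.ball z d)) :
    ∃ v : Plane → ℝ, ContDiff ℝ 2 v ∧ HasCompactSupport v ∧ EqOn v u (Metric.ball z (d / 2)) := by
  let χ : ContDiffBump z := ⟨d / 2, 3 * d / 4, by positivity, by linarith⟩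
  refine ⟨fun x => χ x * u x, ?_, χ.hasCompactSupport.mul_right, fun x hx => ?_⟩
  · refine contDiff_iff_contDiffAt.2 fun x => ?_
    by_cases hx : x ∈ Metric.ball z d
    · exact χ.contDiffAt.mul (hu.contDiffAt (Metric.isOpen_ball.mem_nhds hx))
    · have h1 : x ∉ tsupport χ := by
        rw [χ.tsupport_eq]
        exact fun h => hx (Metric.closedBall_subset_ball (by change 3 * d / 4 < d; linarith) h)
      refine (contDiffAt_const (c := (0 : ℝ))).congr_of_eventuallyEq ?_
      filter_upwards [notMem_tsupport_iff_eventuallyEq.1 h1] with y hy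
      rw [hy, Pi.zero_apply, zero_mul]
  · simp only
    rw [χ.one_of_mem_closedBall (Metric.ball_subset_closedBall hx), one_mul]

/-! ### The interior estimate -/

/-- The Hölder estimate for the gradient at a small distance, in terms of the radius of a ball on
which the equation holds. -/
lemma exists_norm_fderiv_sub_le {γ β : ℝ} (hγ : 1 ≤ γ) (hβ : 1 / (1 - holderExp γ) < β) (D : ℝ)
    (hD : 0 ≤ D) :
    ∃ Q : ℝ, 0 ≤ Q ∧ ∀ (z w : Plane) (d S : ℝ) (u g : Plane → ℝ), 0 < d → d ≤ D → 0 ≤ S →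
      ‖z - w‖ ≤ d / 16 → ContDiffOn ℝ 2 u (Metric.ball z d) →
      (∀ x ∈ Metric.ball z d, |u x| ≤ S) →
      (∀ x ∈ Metric.ball z d,
        hessSq u x ≤ 10 / 9 * (1 + γ) * negHessDet u x + (7 + γ) * g x ^ 2) →
      MemLp g (ENNReal.ofReal (2 * β)) (volume.restrict (Metric.ball z d)) →
      d ^ (1 + holderExp γ) * ‖fderiv ℝ u z - fderiv ℝ u w‖ ≤
        Q * (S + (eLpNorm g (ENNReal.ofReal (2 * β))
          (volume.restrict (Metric.ball z d))).toReal) * ‖z - w‖ ^ holderExp γ := by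
  have hα0 := (holderExp_mem_Ioo hγ).1
  have hα1 := (holderExp_mem_Ioo hγ).2
  have hKα := mul_holderExp_le hγ
  set α := holderExp γ with hα
  set K := 10 / 9 * (1 + γ) with hK
  have hK0 : 0 < K := by positivity
  obtain ⟨C, hC0, hC⟩ := exists_setIntegral_hessSq_le hα0 hα1 hK0 hKα
  obtain ⟨A, hA0, hA⟩ := exists_setIntegral_rpow_mul_sq_le hα0 hα1 hβ D
  have h7γ : 0 ≤ 7 + γ := by linarith
  set Q₁ := 16 + √((7 + γ) * A) * D ^ (1 + α) with hQ₁
  have hQ₁0 : 0 ≤ Q₁ := by positivity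
  refine ⟨8 / α * (√C * Q₁), by positivity, ?_⟩
  intro z w d S u g hd hdD hS0 hzw hu hS hH hg
  set N := (eLpNorm g (ENNReal.ofReal (2 * β)) (volume.restrict (Metric.ball z d))).toReal with hN
  have hN0 : 0 ≤ N := ENNReal.toReal_nonneg
  obtain ⟨v, hv, hvc, hvu⟩ := exists_contDiff_hasCompactSupport_eqOn hd hu
  have hev : ∀ x ∈ Metric.ball z (d / 2), v =ᶠ[𝓝 x] u := fun x hx =>
    Filter.eventuallyEq_of_mem (Metric.isOpen_ball.mem_nhds hx) hvu
  have hhalf : Metric.ball z (d / 2) ⊆ Metric.ball z d := Metric.ball_subset_ball (by linarith)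
  set m := √C * (S * (d / 4) ^ (-(1 + α)) + √((7 + γ) * A) * N) with hm
  have hm0 : 0 ≤ m := by positivity
  -- The growth of the Dirichlet integral at every centre close to `z`.
  have hgrowth : ∀ y, ‖y - z‖ ≤ d / 16 → ∀ r, 0 < r → r ≤ ‖z - w‖ →
      ∫ x in Metric.ball y r, ‖fderiv ℝ (fderiv ℝ v) x‖ ^ 2 ≤ m ^ 2 * r ^ (2 * α) := by
    intro y hy r hr hrw
    have hsub : Metric.ball y (d / 4) ⊆ Metric.ball z (d / 2) :=
      Metric.ball_subset_ball' (by rw [dist_eq_norm]; linarith)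
    have hgy : MemLp g (ENNReal.ofReal (2 * β)) (volume.restrict (Metric.ball y (d / 4))) :=
      hg.mono_measure (Measure.restrict_mono (hsub.trans hhalf) le_rfl)
    obtain ⟨i1, i2, i3⟩ := hA y (d / 4) g (by linarith) hgy
    have hcongr : (fun x => (‖x - y‖ ^ 2) ^ (-α) * ((7 + γ) * g x ^ 2)) =
        fun x => (‖x - y‖ ^ 2) ^ (-α) * g x ^ 2 * (7 + γ) := by
      ext x
      ring
    have h1 := hC y (d / 4) S v (fun x => (7 + γ) * g x ^ 2) (by positivity) hv hvc
      (fun x hx => by rw [hvu (hsub hx)]; exact hS x (hhalf (hsub hx)))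
      (fun x hx => by
        have := hessSq_negHessDet_congr (hev x (hsub hx))
        rw [this.1, this.2]
        exact hH x (hhalf (hsub hx)))
      (fun x _ => by positivity) (i1.const_mul _)
      (by rw [hcongr]; exact i2.mul_const (7 + γ)) r hr (by linarith)
    rw [hcongr, integral_mul_const] at h1
    have hNy : (eLpNorm g (ENNReal.ofReal (2 * β))
        (volume.restrict (Metric.ball y (d / 4)))).toReal ≤ N :=
      ENNReal.toReal_mono hg.2.ne
        (eLpNorm_mono_measure g (Measure.restrict_mono (hsub.trans hhalf) le_rfl))
    have h2 : ∫ x in Metric.ball y r, ‖fderiv ℝ (fderiv ℝ v) x‖ ^ 2 ≤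
        ∫ x in Metric.ball y r, hessSq v x := by
      refine integral_mono_of_nonneg (Eventually.of_forall fun x => by positivity) ?_
        (Eventually.of_forall fun x => norm_fderiv_fderiv_sq_le hv x)
      exact ((continuous_hessSq hv).integrable_of_hasCompactSupport
        (hasCompactSupport_hessSq hvc)).integrableOn
    have h3 : S ^ 2 * (d / 4) ^ (-(2 + 2 * α)) = (S * (d / 4) ^ (-(1 + α))) ^ 2 := by
      rw [mul_pow, ← Real.rpow_natCast ((d / 4) ^ (-(1 + α))), ← Real.rpow_mul (by positivity)]
      congr 2
      push_cast
      ring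
    have h4 : (∫ x in Metric.ball y (d / 4), (‖x - y‖ ^ 2) ^ (-α) * g x ^ 2) * (7 + γ) ≤
        (√((7 + γ) * A) * N) ^ 2 := by
      rw [mul_pow, Real.sq_sqrt (by positivity)]
      calc _ ≤ A * N ^ 2 * (7 + γ) := by
            refine mul_le_mul_of_nonneg_right (i3.trans ?_) h7γ
            exact mul_le_mul_of_nonneg_left (pow_le_pow_left₀ ENNReal.toReal_nonneg hNy 2) hA0
        _ = _ := by ring
    refine h2.trans (h1.trans ?_)
    have hm2 : m ^ 2 = C * (S * (d / 4) ^ (-(1 + α)) + √((7 + γ) * A) * N) ^ 2 := by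
      rw [hm, mul_pow (√C), Real.sq_sqrt hC0]
    rw [h3, hm2]
    have h5 : 0 ≤ S * (d / 4) ^ (-(1 + α)) * (√((7 + γ) * A) * N) := by positivity
    calc _ ≤ C * r ^ (2 * α) * (S * (d / 4) ^ (-(1 + α)) + √((7 + γ) * A) * N) ^ 2 := by
          refine mul_le_mul_of_nonneg_left ?_ (by positivity)
          nlinarith
      _ = _ := by ring
  have hmorrey := norm_sub_le_of_dirichlet_growth (w := fderiv ℝ v)
    (hv.fderiv_right (m := 1) (by norm_num)) hα0 hm0 (z₀ := z) (z₁ := w)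
    (hgrowth z (by simp only [sub_self, norm_zero]; positivity))
    (hgrowth w (by rwa [norm_sub_rev]))
  have hw : w ∈ Metric.ball z (d / 2) := by
    rw [mem_ball_iff_norm, norm_sub_rev]
    linarith
  rw [(hev z (Metric.mem_ball_self (by positivity))).fderiv_eq, (hev w hw).fderiv_eq] at hmorrey
  have hdm : d ^ (1 + α) * m ≤ √C * Q₁ * (S + N) := by
    have h1 : d ^ (1 + α) * (d / 4) ^ (-(1 + α)) ≤ 16 := by
      rw [Real.rpow_neg (by positivity), ← div_eq_mul_inv, ← Real.div_rpow hd.le (by positivity)]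
      have : d / (d / 4) = 4 := by field_simp
      rw [this]
      calc (4 : ℝ) ^ (1 + α) ≤ 4 ^ (2 : ℝ) :=
            Real.rpow_le_rpow_of_exponent_le (by norm_num) (by linarith)
        _ = 16 := by norm_num
    have h2 : d ^ (1 + α) ≤ D ^ (1 + α) := Real.rpow_le_rpow hd.le hdD (by linarith)
    calc d ^ (1 + α) * m = √C * ((d ^ (1 + α) * (d / 4) ^ (-(1 + α))) * S +
          √((7 + γ) * A) * d ^ (1 + α) * N) := by rw [hm]; ring
      _ ≤ √C * (16 * S + √((7 + γ) * A) * D ^ (1 + α) * N) := by gcongr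
      _ ≤ √C * (Q₁ * (S + N)) := by
          refine mul_le_mul_of_nonneg_left ?_ (Real.sqrt_nonneg _)
          have h3 : 0 ≤ √((7 + γ) * A) * D ^ (1 + α) * S := by positivity
          rw [hQ₁]
          linarith
      _ = _ := by ring
  calc _ ≤ d ^ (1 + α) * (8 / α * m * ‖z - w‖ ^ α) :=
        mul_le_mul_of_nonneg_left hmorrey (by positivity)
    _ = 8 / α * ‖z - w‖ ^ α * (d ^ (1 + α) * m) := by ring
    _ ≤ 8 / α * ‖z - w‖ ^ α * (√C * Q₁ * (S + N)) :=
        mul_le_mul_of_nonneg_left hdm (by positivity)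
    _ = _ := by ring

/-- Interpolation: a function with a Hölder continuous gradient has its gradient bounded by the
supremum of the function and the Hölder constant. -/
lemma mul_norm_fderiv_le_of_holder {u : Plane → ℝ} {z : Plane} {d S Q α : ℝ} (hα0 : 0 ≤ α)
    (hd : 0 < d) (hu : ∀ x ∈ Metric.ball z d, DifferentiableAt ℝ u x)
    (hS : ∀ x ∈ Metric.ball z d, |u x| ≤ S)
    (hQ : ∀ w, ‖z - w‖ ≤ d / 16 →
      d ^ (1 + α) * ‖fderiv ℝ u z - fderiv ℝ u w‖ ≤ Q * ‖z - w‖ ^ α) :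
    d * ‖fderiv ℝ u z‖ ≤ 32 * S + Q := by
  have hz : z ∈ Metric.ball z d := Metric.mem_ball_self hd
  have hQ0 : 0 ≤ Q := by
    have h := hQ (z + (d / 16) • EuclideanSpace.single 0 1)
      (by simp [norm_smul, abs_of_pos hd])
    have hpos : 0 < ‖z - (z + (d / 16) • EuclideanSpace.single 0 (1 : ℝ))‖ ^ α := by
      refine Real.rpow_pos_of_pos ?_ _
      simp [norm_smul]
      positivity
    exact nonneg_of_mul_nonneg_left ((by positivity : (0 : ℝ) ≤ _).trans h) hpos
  have hosc : ∀ w ∈ Metric.closedBall z (d / 16), d * ‖fderiv ℝ u w - fderiv ℝ u z‖ ≤ Q := by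
    intro w hw
    rw [mem_closedBall_iff_norm, norm_sub_rev] at hw
    have h := hQ w hw
    rw [norm_sub_rev, Real.rpow_add hd, Real.rpow_one] at h
    have h1 : ‖z - w‖ ^ α ≤ d ^ α := Real.rpow_le_rpow (norm_nonneg _) (by linarith) hα0
    have h2 := h.trans (mul_le_mul_of_nonneg_left h1 hQ0)
    have h3 : 0 < d ^ α := by positivity
    refine le_of_mul_le_mul_right ?_ h3
    linarith
  have hbound : ‖fderiv ℝ u z‖ ≤ (32 * S + Q) / d := by
    have hS0 : 0 ≤ S := (abs_nonneg _).trans (hS z hz)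
    refine ContinuousLinearMap.opNorm_le_of_unit_norm (by positivity) fun v hv => ?_
    set h := d / 16 with hh
    have hh0 : 0 < h := by positivity
    have hsub : Metric.closedBall z h ⊆ Metric.ball z d :=
      Metric.closedBall_subset_ball (by rw [hh]; linarith)
    have hy : z + h • v ∈ Metric.closedBall z h := by
      rw [mem_closedBall_iff_norm, add_sub_cancel_left, norm_smul, hv, mul_one,
        Real.norm_of_nonneg hh0.le]
    have hmv := (convex_closedBall z h).norm_image_sub_le_of_norm_hasFDerivWithin_le'
      (f := u) (f' := fderiv ℝ u) (φ := fderiv ℝ u z) (C := Q / d)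
      (fun x hx => (hu x (hsub hx)).hasFDerivAt.hasFDerivWithinAt)
      (fun x hx => by
        rw [le_div_iff₀ hd, mul_comm]
        exact hosc x hx)
      (Metric.mem_closedBall_self hh0.le) hy
    rw [add_sub_cancel_left, map_smul, norm_smul, hv, mul_one, Real.norm_of_nonneg hh0.le,
      Real.norm_eq_abs, smul_eq_mul] at hmv
    have h1 := hS z hz
    have h2 := hS _ (hsub hy)
    have h3 : h * |fderiv ℝ u z v| ≤ 2 * S + Q / d * h := by
      rw [← abs_of_pos hh0, ← abs_mul, abs_of_pos hh0]
      rw [abs_le] at *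
      constructor <;> linarith
    rw [Real.norm_eq_abs]
    refine le_of_mul_le_mul_left (h3.trans (le_of_eq ?_)) hh0
    rw [hh]
    field_simp
    ring
  rw [le_div_iff₀ hd] at hbound
  linarith

lemma ball_bdist_subset {Ω : Set Plane} (hΩ : IsOpen Ω) {z : Plane} (hz : z ∈ Ω) :
    Metric.ball z (bdist Ω z) ⊆ Ω := by
  rcases (Metric.infDist_nonneg (x := z) (s := frontier Ω)).eq_or_lt with h0 | h0
  · rw [bdist, ← h0, Metric.ball_zero]
    exact empty_subset _
  have hpre : IsPreconnected (Metric.ball z (bdist Ω z)) := (convex_ball _ _).isPreconnected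
  refine hpre.subset_left_of_subset_union hΩ isClosed_closure.isOpen_compl
    (disjoint_compl_right.mono_left subset_closure) (fun x hx => ?_)
    ⟨z, Metric.mem_ball_self h0, hz⟩
  by_contra hx'
  rw [mem_union, not_or, notMem_compl_iff] at hx'
  have hfr : x ∈ frontier Ω := by
    rw [hΩ.frontier_eq]
    exact ⟨hx'.2, hx'.1⟩
  have h1 := Metric.infDist_le_dist_of_mem (x := z) hfr
  rw [Metric.mem_ball, dist_comm] at hx
  exact absurd hx (not_lt.2 h1)

lemma bdist_le_diam {Ω : Set Plane} (hΩb : Bornology.IsBounded Ω) {z : Plane} (hz : z ∈ Ω) :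
    bdist Ω z ≤ Metric.diam Ω := by
  rcases (frontier Ω).eq_empty_or_nonempty with h | ⟨y, hy⟩
  · rw [bdist, h, Metric.infDist_empty]
    exact Metric.diam_nonneg
  · refine (Metric.infDist_le_dist_of_mem hy).trans ?_
    rw [← Metric.diam_closure]
    exact Metric.dist_le_diam_of_mem hΩb.closure (subset_closure hz) (frontier_subset_closure hy)

/-- The interior estimate with real-valued bounds, for a bounded solution. -/
lemma exists_interior_bounds {Ω : Set Plane} (hΩ : IsOpen Ω) (hΩb : Bornology.IsBounded Ω)
    {γ β : ℝ} (hγ : 1 ≤ γ) (hβ : 1 / (1 - holderExp γ) < β) :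
    ∃ P : ℝ, 0 ≤ P ∧ ∀ (u g : Plane → ℝ) (S : ℝ), 0 ≤ S → ContDiffOn ℝ 2 u Ω →
      (∀ x ∈ Ω, |u x| ≤ S) →
      (∀ x ∈ Ω, hessSq u x ≤ 10 / 9 * (1 + γ) * negHessDet u x + (7 + γ) * g x ^ 2) →
      MemLp g (ENNReal.ofReal (2 * β)) (volume.restrict Ω) →
      (∀ z ∈ Ω, bdist Ω z * ‖fderiv ℝ u z‖ ≤
        P * (S + (eLpNorm g (ENNReal.ofReal (2 * β)) (volume.restrict Ω)).toReal)) ∧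
      (∀ z ∈ Ω, ∀ w ∈ Ω, z ≠ w → (min (bdist Ω z) (bdist Ω w)) ^ (1 + holderExp γ) *
        (‖fderiv ℝ u z - fderiv ℝ u w‖ / ‖z - w‖ ^ holderExp γ) ≤
        P * (S + (eLpNorm g (ENNReal.ofReal (2 * β)) (volume.restrict Ω)).toReal)) := by
  have hα0 := (holderExp_mem_Ioo hγ).1
  have hα1 := (holderExp_mem_Ioo hγ).2
  set α := holderExp γ with hα
  obtain ⟨Q, hQ0, hQ⟩ := exists_norm_fderiv_sub_le hγ hβ (Metric.diam Ω) Metric.diam_nonneg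
  refine ⟨32 * (32 + Q), by positivity, ?_⟩
  intro u g S hS0 hu hS hH hg
  set N := (eLpNorm g (ENNReal.ofReal (2 * β)) (volume.restrict Ω)).toReal with hN
  have hN0 : 0 ≤ N := ENNReal.toReal_nonneg
  have hSN : 0 ≤ S + N := by positivity
  have hlocal : ∀ z ∈ Ω, ∀ d, 0 < d → d ≤ bdist Ω z → ∀ w, ‖z - w‖ ≤ d / 16 →
      d ^ (1 + α) * ‖fderiv ℝ u z - fderiv ℝ u w‖ ≤ Q * (S + N) * ‖z - w‖ ^ α := by
    intro z hz d hd hdz w hw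
    have hsub : Metric.ball z d ⊆ Ω := (Metric.ball_subset_ball hdz).trans (ball_bdist_subset hΩ hz)
    have hle := Measure.restrict_mono hsub (le_refl (volume : Measure Plane))
    refine (hQ z w d S u g hd (hdz.trans (bdist_le_diam hΩb hz)) hS0 hw (hu.mono hsub)
      (fun x hx => hS x (hsub hx)) (fun x hx => hH x (hsub hx)) (hg.mono_measure hle)).trans ?_
    refine mul_le_mul_of_nonneg_right ?_ (by positivity)
    refine mul_le_mul_of_nonneg_left ?_ hQ0
    have := ENNReal.toReal_mono hg.2.ne
      (eLpNorm_mono_measure (p := ENNReal.ofReal (2 * β)) g hle)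
    linarith
  have hgrad : ∀ z ∈ Ω, bdist Ω z * ‖fderiv ℝ u z‖ ≤ (32 + Q) * (S + N) := by
    intro z hz
    rcases (Metric.infDist_nonneg (x := z) (s := frontier Ω)).eq_or_lt with h0 | h0
    · rw [bdist, ← h0, zero_mul]
      positivity
    · have hsub := ball_bdist_subset hΩ hz
      have := mul_norm_fderiv_le_of_holder (u := u) (z := z) (d := bdist Ω z) hα0.le h0
        (fun x hx => (hu.contDiffAt (hΩ.mem_nhds (hsub hx))).differentiableAt (by norm_num))
        (fun x hx => hS x (hsub hx)) (hlocal z hz _ h0 le_rfl)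
      linarith
  refine ⟨fun z hz => (hgrad z hz).trans ?_, fun z hz w hw hne => ?_⟩
  · have : 0 ≤ (32 + Q) * (S + N) := by positivity
    linarith
  · set d := min (bdist Ω z) (bdist Ω w) with hd
    have hd0 : 0 ≤ d := le_min Metric.infDist_nonneg Metric.infDist_nonneg
    have hzw : 0 < ‖z - w‖ := norm_pos_iff.2 (sub_ne_zero.2 hne)
    have hzwα : 0 < ‖z - w‖ ^ α := by positivity
    rcases hd0.eq_or_lt with h0 | hd0
    · rw [← h0, Real.zero_rpow (by linarith), zero_mul]
      positivity
    rw [← mul_div_assoc, div_le_iff₀ hzwα]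
    rcases le_or_gt ‖z - w‖ (d / 16) with hle | hgt
    · refine (hlocal z hz d hd0 (min_le_left _ _) w hle).trans ?_
      refine mul_le_mul_of_nonneg_right ?_ hzwα.le
      refine mul_le_mul_of_nonneg_right ?_ hSN
      linarith
    · -- Far apart points: the two gradients are bounded separately.
      have h1 : d * ‖fderiv ℝ u z - fderiv ℝ u w‖ ≤ 2 * ((32 + Q) * (S + N)) := by
        have hz' := (mul_le_mul_of_nonneg_right (min_le_left (bdist Ω z) (bdist Ω w))
          (norm_nonneg (fderiv ℝ u z))).trans (hgrad z hz)
        have hw' := (mul_le_mul_of_nonneg_right (min_le_right (bdist Ω z) (bdist Ω w))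
          (norm_nonneg (fderiv ℝ u w))).trans (hgrad w hw)
        calc _ ≤ d * (‖fderiv ℝ u z‖ + ‖fderiv ℝ u w‖) :=
              mul_le_mul_of_nonneg_left (norm_sub_le _ _) hd0.le
          _ ≤ _ := by linarith
      have h2 : d ^ α ≤ 16 * ‖z - w‖ ^ α := by
        calc d ^ α ≤ (16 * ‖z - w‖) ^ α := Real.rpow_le_rpow hd0.le (by linarith) hα0.le
          _ = 16 ^ α * ‖z - w‖ ^ α := Real.mul_rpow (by norm_num) hzw.le
          _ ≤ 16 * ‖z - w‖ ^ α := by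
            refine mul_le_mul_of_nonneg_right ?_ hzwα.le
            calc (16 : ℝ) ^ α ≤ 16 ^ (1 : ℝ) :=
                  Real.rpow_le_rpow_of_exponent_le (by norm_num) hα1.le
              _ = 16 := Real.rpow_one _
      rw [Real.rpow_add hd0, Real.rpow_one]
      calc _ = d ^ α * (d * ‖fderiv ℝ u z - fderiv ℝ u w‖) := by ring
        _ ≤ 16 * ‖z - w‖ ^ α * (2 * ((32 + Q) * (S + N))) := by
            gcongr
        _ = _ := by ring

end PlanarElliptic

theorem mainTheorem8
    (Ω : Set PlanarElliptic.Plane) (hΩ : IsOpen Ω) (hΩb : Bornology.IsBounded Ω)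
    (γ : ℝ) (hγ : 1 ≤ γ) (β : ℝ) (hβ : 1 / (1 - PlanarElliptic.holderExp γ) < β) :
    PlanarElliptic.holderExp γ ∈ Set.Ioo (0 : ℝ) 1 ∧
    ∃ C : ℝ≥0, ∀ a b c f l m u : PlanarElliptic.Plane → ℝ,
      ContDiffOn ℝ 2 u Ω →
      (∀ z ∈ Ω, PlanarElliptic.ellipticOp a b c u z = f z) →
      PlanarElliptic.AreEigenvalues Ω a b c l m →
      (∀ z ∈ Ω, 0 < l z) →
      (∀ z ∈ Ω, m z / l z ≤ γ) →
      MeasureTheory.MemLp (fun z => f z / l z) (ENNReal.ofReal (2 * β))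
        (MeasureTheory.volume.restrict Ω) →
      PlanarElliptic.intNorm Ω (PlanarElliptic.holderExp γ) u ≤
        C * (PlanarElliptic.supNorm Ω u +
          MeasureTheory.eLpNorm (fun z => f z / l z) (ENNReal.ofReal (2 * β))
            (MeasureTheory.volume.restrict Ω)) := by
  refine ⟨PlanarElliptic.holderExp_mem_Ioo hγ, ?_⟩
  obtain ⟨P, hP0, hP⟩ := PlanarElliptic.exists_interior_bounds hΩ hΩb hγ hβ
  refine ⟨1 + 2 * P.toNNReal, fun a b c f l m u hu heq heig hl0 hml hg => ?_⟩
  set E := MeasureTheory.eLpNorm (fun z => f z / l z) (ENNReal.ofReal (2 * β))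
    (MeasureTheory.volume.restrict Ω) with hE
  rcases eq_or_ne (PlanarElliptic.supNorm Ω u) ∞ with htop | hfin
  · rw [htop, top_add, ENNReal.mul_top]
    · exact le_top
    · norm_cast
      positivity
  have hS : ∀ x ∈ Ω, |u x| ≤ (PlanarElliptic.supNorm Ω u).toReal := fun x hx =>
    (ENNReal.ofReal_le_iff_le_toReal hfin).1
      (le_iSup₂ (f := fun z (_ : z ∈ Ω) => ENNReal.ofReal |u z|) x hx)
  obtain ⟨h1, h2⟩ := hP u (fun z => f z / l z) _ ENNReal.toReal_nonneg hu hS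
    (fun x hx => PlanarElliptic.hessSq_le_of_equation heq heig hl0 hml hx) hg
  have hbound : ENNReal.ofReal (P * ((PlanarElliptic.supNorm Ω u).toReal + E.toReal)) =
      P.toNNReal * (PlanarElliptic.supNorm Ω u + E) := by
    rw [ENNReal.ofReal_mul hP0, ENNReal.ofReal_add ENNReal.toReal_nonneg ENNReal.toReal_nonneg,
      ENNReal.ofReal_toReal hfin, ENNReal.ofReal_toReal hg.2.ne]
    rfl
  have h3 : PlanarElliptic.intSeminormOne Ω u ≤ P.toNNReal * (PlanarElliptic.supNorm Ω u + E) := by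
    rw [← hbound]
    exact iSup₂_le fun z hz => ENNReal.ofReal_le_ofReal (h1 z hz)
  have h4 : PlanarElliptic.intSeminormHolder Ω (PlanarElliptic.holderExp γ) u ≤
      P.toNNReal * (PlanarElliptic.supNorm Ω u + E) := by
    rw [← hbound]
    exact iSup₂_le fun z hz => iSup₂_le fun w hw => iSup_le fun hne =>
      ENNReal.ofReal_le_ofReal (h2 z hz w hw hne)
  calc PlanarElliptic.intNorm Ω (PlanarElliptic.holderExp γ) u
      ≤ (PlanarElliptic.supNorm Ω u + E) + P.toNNReal * (PlanarElliptic.supNorm Ω u + E) +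
        P.toNNReal * (PlanarElliptic.supNorm Ω u + E) :=
        add_le_add (add_le_add le_self_add h3) h4
    _ = _ := by
      push_cast
      ring
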